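/- Let $n\ge 2$. For integers $p,q$ put $[p,q]:=\{i\in\mathbb Z\mid p\le i\le q\}$, and for $X\subset\mathbb Z$ put $-X:=\{-x\mid x\in X\}$ and $\pm X:=X\cup(-X)$. Let $W=W(D_n)$ be the Coxeter group of type $D_n$, identified with the group of all permutations $w$ of $\pm[1,n]$ such that $w(-i)=-w(i)$ for all $i$ and $\#\{i\in[1,n]\mid w(i)<0\}$ is even; its simple reflections are $s_{-1}=(-1\ \ 2)(-2\ \ 1)$ and $s_i=(-i\ \ -(i+1))(i\ \ i+1)$ for $i\in[1,n-1]$. Let $l$ be the length function with respect to these generators and order $W$ by the right weak order: $v\le w$ if and only if $l(w)=l(v)+l(v^{-1}w)$; this is a finite lattice. For $w\in W$ let $\mathrm{des}(w):=\{i\in\{-1\}\cup[1,n-1]\mid ws_i<w\}$. A join-irreducible element $u$ of $W$ has exactly one descent $t$, called its type, and we put $R(u):=u([|t|+1,n])$. A set $U\subset W$ is the canonical join representation of $w$ if (a) $w=\bigvee U$; (b) $w\neq\bigvee U'$ for every proper subset $U'\subsetneq U$; and (c) whenever $V\subset W$ satisfies (a) and (b), each $u\in U$ satisfies $u\le v$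 for some $v\in V$. Let $w\in W$, and for $d\in\mathrm{des}(w)$ put $a_d:=w(d)$, $b_d:=w(|d|+1)$, $X_d:=w([|d|+1,n])$. Define $R_d$ as follows. (A) If $a_d+b_d<0$ and $w([1,|d|])\subset\pm[a_d,n]$, then $$R_d=\begin{cases}\{-a_d\}\cup(\pm[1,a_d-1]\cap X_d)\cup([a_d+1,-b_d-1]\setminus(-X_d))\cup[-b_d+1,n]&(a_d>0),\\ ([-a_d,-b_d-1]\setminus(-X_d))\cup[-b_d+1,n]&(a_d<0).\end{cases}$$ (B) Otherwise, $$R_d=\begin{cases}([b_d,a_d-1]\cap X_d)\cup[a_d+1,n]&(a_d+b_d>0),\\ ([b_d,a_d-1]\cap X_d)\cup([a_d+1,-b_d-1]\setminus(-X_d))\cup[-b_d+1,n]&(a_d+b_d<0).\end{cases}$$ Then for every $d\in\mathrm{des}(w)$ there is a unique join-irreducible element $w_d\in W$ with $R(w_d)=R_d$; the elements $w_d$ $(d\in\mathrm{des}(w))$ are pairwise distinct, and $w=\bigvee_{d\in\mathrm{des}(w)}w_d$ is the canonical join representation of $w$. -/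

import Mathlib

/-! ### Joins in a finite lattice

All three notions are phrased with least upper bounds (`IsLUB`), so that they make sense in any
partial order and are the usual ones when the order is a lattice. -/

/-- `x` is join-irreducible: it is not the minimum, and whenever `x` is the join of `y` and `z`,
one of `y`, `z` equals `x`. -/
def IsJoinIrreducible {L : Type*} [PartialOrder L] (x : L) : Prop :=
  ¬ IsBot x ∧ ∀ y z : L, IsLUB {y, z} x → y = x ∨ z = x

/-- `U` is an irredundant join representation of `x`: the join of `U` is `x`, and the join of a
proper subset of `U` never is. -/
def IsIrredundantJoin {L : Type*} [PartialOrder L] (x : L) (U : Set L) : Prop :=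
  IsLUB U x ∧ ∀ U' : Set L, U' ⊂ U → ¬ IsLUB U' x

/-- `U` is a canonical join representation of `x`: it is an irredundant join representation of
`x`, and for every irredundant join representation `V` of `x`, each element of `U` lies below some
element of `V`. -/
def IsCanonicalJoinRep {L : Type*} [PartialOrder L] (x : L) (U : Set L) : Prop :=
  IsIrredundantJoin x U ∧
    ∀ V : Set L, IsIrredundantJoin x V → ∀ u ∈ U, ∃ v ∈ V, u ≤ v

namespace TypeD

/-! ### The Coxeter group of type `D n` -/

/-- The sign of a nonzero integer. -/
def sgn (x : ℤ) : ℤ := if x < 0 then -1 else 1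

theorem sgn_mul_self (x : ℤ) : sgn x * sgn x = 1 := by
  unfold sgn; split_ifs <;> rfl

/-- Permutations of `ℤ` that commute with negation and fix everything outside `[-n, n]`, that is,
the signed permutations of `±[1, n]` (such a permutation fixes `0`). -/
def IsSigned (n : ℕ) (w : Equiv.Perm ℤ) : Prop :=
  (∀ i, w (-i) = -w i) ∧ ∀ i, (n : ℤ) < |i| → w i = i

theorem IsSigned.zero {n : ℕ} {w : Equiv.Perm ℤ} (hw : IsSigned n w) : w 0 = 0 := by
  have := hw.1 0
  simp only [neg_zero] at this
  omega

theorem IsSigned.ne_zero {n : ℕ} {w : Equiv.Perm ℤ} (hw : IsSigned n w) {i : ℤ} (hi : i ≠ 0) :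
    w i ≠ 0 := fun h => hi (w.injective (h.trans hw.zero.symm))

theorem IsSigned.abs_le {n : ℕ} {w : Equiv.Perm ℤ} (hw : IsSigned n w) {i : ℤ}
    (hi : |i| ≤ n) : |w i| ≤ n := by
  by_contra h
  push Not at h
  have h1 := w.injective (hw.2 (w i) h)
  rw [h1] at h
  omega

theorem IsSigned.abs_inj {n : ℕ} {w : Equiv.Perm ℤ} (hw : IsSigned n w) {i j : ℤ}
    (hi : 0 < i) (hj : 0 < j) (h : |w i| = |w j|) : i = j := by
  rcases abs_eq_abs.1 h with h | h
  · exact w.injective h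
  · rw [← hw.1] at h
    have := w.injective h
    omega

theorem IsSigned.one (n : ℕ) : IsSigned n 1 := ⟨fun _ => rfl, fun _ _ => rfl⟩

theorem IsSigned.mul {n : ℕ} {v w : Equiv.Perm ℤ} (hv : IsSigned n v) (hw : IsSigned n w) :
    IsSigned n (v * w) :=
  ⟨fun i => by simp [hw.1, hv.1], fun i hi => by simp [hw.2 i hi, hv.2 i hi]⟩

theorem IsSigned.inv {n : ℕ} {w : Equiv.Perm ℤ} (hw : IsSigned n w) : IsSigned n w⁻¹ := by
  refine ⟨fun i => ?_, fun i hi => ?_⟩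
  · rw [Equiv.Perm.inv_eq_iff_eq, hw.1]; simp
  · rw [Equiv.Perm.inv_eq_iff_eq, hw.2 i hi]

/-- The number of `i ∈ [1, n]` with `w i < 0`. -/
noncomputable def negCount (n : ℕ) (w : Equiv.Perm ℤ) : ℕ :=
  ((Finset.Icc (1 : ℤ) n).filter fun i => w i < 0).card

theorem neg_one_pow_negCount (n : ℕ) (w : Equiv.Perm ℤ) :
    (-1 : ℤ) ^ negCount n w = ∏ i ∈ Finset.Icc (1 : ℤ) n, sgn (w i) := by
  simp only [sgn, negCount]
  rw [Finset.prod_ite]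
  simp

theorem IsSigned.image_abs {n : ℕ} {w : Equiv.Perm ℤ} (hw : IsSigned n w) :
    (Finset.Icc (1 : ℤ) n).image (fun i => |w i|) = Finset.Icc (1 : ℤ) n := by
  apply Finset.eq_of_subset_of_card_le
  · intro x hx
    obtain ⟨i, hi, rfl⟩ := Finset.mem_image.1 hx
    rw [Finset.mem_Icc] at hi ⊢
    have h1 := hw.abs_le (i := i) (by rw [abs_of_pos] <;> omega)
    have h2 := abs_pos.2 (hw.ne_zero (i := i) (by omega))
    omega
  · rw [Finset.card_image_of_injOn]
    intro i hi j hj h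
    have hi' := Finset.mem_Icc.1 hi
    have hj' := Finset.mem_Icc.1 hj
    exact hw.abs_inj (by omega) (by omega) h

theorem IsSigned.sgn_comp {n : ℕ} {w : Equiv.Perm ℤ} (hw : IsSigned n w) {x : ℤ} (hx : x ≠ 0) :
    sgn (w x) = sgn (w |x|) * sgn x := by
  have h0 := hw.ne_zero hx
  rcases lt_or_gt_of_ne hx with h | h
  · rw [abs_of_neg h, hw.1]
    unfold sgn
    split_ifs <;> first | rfl | omega
  · rw [abs_of_pos h]
    unfold sgn
    split_ifs <;> first | rfl | omega

theorem neg_one_pow_negCount_mul {n : ℕ} {v w : Equiv.Perm ℤ} (hv : IsSigned n v)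
    (hw : IsSigned n w) :
    (-1 : ℤ) ^ negCount n (v * w) = (-1) ^ negCount n v * (-1) ^ negCount n w := by
  simp only [neg_one_pow_negCount]
  have h1 : ∏ i ∈ Finset.Icc (1 : ℤ) n, sgn (v i) = ∏ i ∈ Finset.Icc (1 : ℤ) n, sgn (v |w i|) := by
    conv_lhs => rw [← hw.image_abs]
    rw [Finset.prod_image]
    intro i hi j hj h
    have hi' := Finset.mem_Icc.1 hi
    have hj' := Finset.mem_Icc.1 hj
    exact hw.abs_inj (by omega) (by omega) h
  rw [h1, ← Finset.prod_mul_distrib]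
  refine Finset.prod_congr rfl fun i hi => ?_
  have hi' := Finset.mem_Icc.1 hi
  rw [Equiv.Perm.mul_apply]
  exact hv.sgn_comp (hw.ne_zero (by omega))

/-- The Coxeter group of type `D n`, as the group of all permutations `w` of `±[1, n]` with
`w (-i) = -w i` for all `i` and with an even number of `i ∈ [1, n]` such that `w i < 0`. The
permutation is extended by the identity to all integers. -/
def W (n : ℕ) : Subgroup (Equiv.Perm ℤ) where
  carrier := {w | IsSigned n w ∧ Even (negCount n w)}
  one_mem' := by
    refine ⟨IsSigned.one n, ?_⟩
    have : negCount n 1 = 0 := by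
      unfold negCount
      rw [Finset.card_eq_zero, Finset.filter_eq_empty_iff]
      intro i hi
      have hi' := Finset.mem_Icc.1 hi
      simp only [Equiv.Perm.one_apply]
      omega
    rw [this]
    exact Even.zero
  mul_mem' := by
    rintro v w ⟨hv, hv'⟩ ⟨hw, hw'⟩
    refine ⟨hv.mul hw, ?_⟩
    rw [← neg_one_pow_eq_one_iff_even (R := ℤ) (by decide)] at *
    rw [neg_one_pow_negCount_mul hv hw, hv', hw', one_mul]
  inv_mem' := by
    rintro w ⟨hw, hw'⟩
    refine ⟨hw.inv, ?_⟩
    have h := neg_one_pow_negCount_mul hw.inv hw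
    rw [inv_mul_cancel] at h
    have h1 : (-1 : ℤ) ^ negCount n 1 = 1 := by
      rw [neg_one_pow_negCount]
      refine Finset.prod_eq_one fun i hi => ?_
      have hi' := Finset.mem_Icc.1 hi
      rw [Equiv.Perm.one_apply]
      exact if_neg (by omega)
    rw [← neg_one_pow_eq_one_iff_even (R := ℤ) (by decide)] at *
    rw [h1, hw', mul_one] at h
    exact h.symm

/-- The vertices `{-1} ∪ [1, n - 1]` of the Dynkin diagram `D n` (for `n ≥ 2`). -/
abbrev Node (n : ℕ) : Type := {i : ℤ // (i = -1 ∨ 1 ≤ i) ∧ |i| + 1 ≤ n}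

/-- The permutation `(-1 2)(-2 1)` if `i = -1`, and `(-i -(i+1))(i i+1)` otherwise. -/
def simplePerm (i : ℤ) : Equiv.Perm ℤ :=
  if i = -1 then Equiv.swap (-1) 2 * Equiv.swap (-2) 1
  else Equiv.swap (-i) (-(i + 1)) * Equiv.swap i (i + 1)

theorem simplePerm_neg_one (x : ℤ) : simplePerm (-1) x =
    if x = 1 then -2 else if x = 2 then -1 else if x = -1 then 2 else if x = -2 then 1 else x := by
  simp only [simplePerm, if_true, Equiv.Perm.mul_apply, Equiv.swap_apply_def]
  split_ifs <;> simp_all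

theorem simplePerm_pos {i : ℤ} (hi : 1 ≤ i) (x : ℤ) : simplePerm i x =
    if x = i then i + 1 else if x = i + 1 then i else if x = -i then -(i + 1)
    else if x = -(i + 1) then -i else x := by
  rw [simplePerm, if_neg (show i ≠ -1 by omega), Equiv.Perm.mul_apply,
    Equiv.swap_apply_def, Equiv.swap_apply_def]
  split_ifs <;> omega

theorem simplePerm_mem {n : ℕ} (i : Node n) : simplePerm i ∈ W n := by
  obtain ⟨i, hi | hi, hn⟩ := i
  · subst hi
    simp only [abs_neg, abs_one] at hn
    refine ⟨⟨fun x => ?_, fun x hx => ?_⟩, ?_⟩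
    · simp only [simplePerm_neg_one]
      split_ifs <;> omega
    · simp only [simplePerm_neg_one]
      rcases abs_cases x with ⟨h, h'⟩ | ⟨h, h'⟩ <;> rw [h] at hx <;> split_ifs <;> omega
    · have : (Finset.Icc (1 : ℤ) n).filter (fun x => simplePerm (-1) x < 0) = {1, 2} := by
        ext x
        simp only [simplePerm_neg_one, Finset.mem_filter, Finset.mem_Icc, Finset.mem_insert,
          Finset.mem_singleton]
        split_ifs <;> omega
      unfold negCount
      rw [this]
      decide
  · rw [abs_of_pos (by omega)] at hn
    refine ⟨⟨fun x => ?_, fun x hx => ?_⟩, ?_⟩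
    · simp only [simplePerm_pos hi]
      split_ifs <;> omega
    · simp only [simplePerm_pos hi]
      rcases abs_cases x with ⟨h, h'⟩ | ⟨h, h'⟩ <;> rw [h] at hx <;> split_ifs <;> omega
    · have : (Finset.Icc (1 : ℤ) n).filter (fun x => simplePerm i x < 0) = ∅ := by
        rw [Finset.filter_eq_empty_iff]
        intro x hx
        have hx' := Finset.mem_Icc.1 hx
        rw [simplePerm_pos hi]
        split_ifs <;> omega
      unfold negCount
      rw [this]
      decide

/-- The simple reflections of the Coxeter group. -/
def s {n : ℕ} (i : Node n) : W n := ⟨simplePerm i, simplePerm_mem i⟩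

theorem s_mul_self {n : ℕ} (i : Node n) : s i * s i = 1 := by
  apply Subtype.ext
  apply Equiv.ext
  intro x
  obtain ⟨i, hi | hi, hn⟩ := i
  · subst hi
    simp only [s, Subgroup.coe_mul, Equiv.Perm.mul_apply, simplePerm_neg_one, Subgroup.coe_one,
      Equiv.Perm.one_apply]
    split_ifs <;> simp_all
  · simp only [s, Subgroup.coe_mul, Equiv.Perm.mul_apply, simplePerm_pos hi, Subgroup.coe_one,
      Equiv.Perm.one_apply]
    split_ifs <;> omega

/-- The Coxeter length: the least number of simple reflections whose product is `w`. -/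
noncomputable def length {n : ℕ} (w : W n) : ℕ :=
  sInf {k | ∃ L : List (Node n), L.length = k ∧ (L.map s).prod = w}

/-! Every element is a product of simple reflections, so the length is a genuine minimum. -/

/-- A bounded statistic that grows when a descent is removed. -/
noncomputable def potential (n : ℕ) (w : Equiv.Perm ℤ) : ℤ :=
  ∑ k ∈ Finset.Icc (1 : ℤ) n, k * w k

theorem potential_le {n : ℕ} (w : W n) :
    potential n w ≤ ∑ _k ∈ Finset.Icc (1 : ℤ) n, (n : ℤ) * n := by
  refine Finset.sum_le_sum fun k hk => ?_
  have hk' := Finset.mem_Icc.1 hk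
  have h := w.2.1.abs_le (i := k) (by rw [abs_of_pos] <;> omega)
  have h' := le_trans (le_abs_self _) h
  nlinarith

theorem potential_lt {n : ℕ} (w : W n) (i : Node n)
    (hi : (w : Equiv.Perm ℤ) (|(i : ℤ)| + 1) < (w : Equiv.Perm ℤ) i) :
    potential n w < potential n (w * s i : W n) := by
  have key : ∀ a b : ℤ, a ≠ b → a ∈ Finset.Icc (1 : ℤ) n → b ∈ Finset.Icc (1 : ℤ) n →
      ∀ f g : ℤ → ℤ, (∀ x ∈ Finset.Icc (1 : ℤ) n, x ≠ a → x ≠ b → f x = g x) →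
      f a + f b < g a + g b →
      ∑ k ∈ Finset.Icc (1 : ℤ) n, f k < ∑ k ∈ Finset.Icc (1 : ℤ) n, g k := by
    intro a b hab ha hb f g hfg hlt
    have hb' : b ∈ (Finset.Icc (1 : ℤ) n).erase a := Finset.mem_erase.2 ⟨hab.symm, hb⟩
    rw [← Finset.add_sum_erase _ f ha, ← Finset.add_sum_erase _ f hb',
      ← Finset.add_sum_erase _ g ha, ← Finset.add_sum_erase _ g hb']
    have : ∑ x ∈ ((Finset.Icc (1 : ℤ) n).erase a).erase b, f x =
        ∑ x ∈ ((Finset.Icc (1 : ℤ) n).erase a).erase b, g x := by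
      refine Finset.sum_congr rfl fun x hx => ?_
      simp only [Finset.mem_erase] at hx
      exact hfg x hx.2.2 hx.2.1 hx.1
    omega
  have hodd := w.2.1.1
  obtain ⟨i, h | h, hn⟩ := i
  · subst h
    simp only [abs_neg, abs_one] at hn hi
    refine key 1 2 (by norm_num) (Finset.mem_Icc.2 ⟨by norm_num, by omega⟩)
      (Finset.mem_Icc.2 ⟨by norm_num, by omega⟩) _ _ (fun x hx h1 h2 => ?_) ?_
    · have hx' := Finset.mem_Icc.1 hx
      simp only [s, Subgroup.coe_mul, Equiv.Perm.mul_apply, simplePerm_neg_one]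
      rw [if_neg h1, if_neg h2, if_neg (by omega), if_neg (by omega)]
    · simp only [s, Subgroup.coe_mul, Equiv.Perm.mul_apply, simplePerm_neg_one]
      have e1 := hodd 1
      have e2 := hodd 2
      norm_num at *
      rw [e1, e2]
      rw [e1] at hi
      linarith
  · rw [abs_of_pos (by omega)] at hn
    have hi' : (w : Equiv.Perm ℤ) (i + 1) < (w : Equiv.Perm ℤ) i := by
      simpa [abs_of_pos (show 0 < i by omega)] using hi
    refine key i (i + 1) (by omega) (Finset.mem_Icc.2 ⟨by omega, by omega⟩)
      (Finset.mem_Icc.2 ⟨by omega, by omega⟩) _ _ (fun x hx h1 h2 => ?_) ?_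
    · have hx' := Finset.mem_Icc.1 hx
      simp only [s, Subgroup.coe_mul, Equiv.Perm.mul_apply, simplePerm_pos h]
      rw [if_neg h1, if_neg h2, if_neg (by omega), if_neg (by omega)]
    · simp only [s, Subgroup.coe_mul, Equiv.Perm.mul_apply, simplePerm_pos h]
      simp only [if_true, if_neg (show i + 1 ≠ i by omega)]
      linarith

theorem eq_one_of_forall_le {n : ℕ} (w : W n)
    (h : ∀ i : Node n, (w : Equiv.Perm ℤ) i ≤ (w : Equiv.Perm ℤ) (|(i : ℤ)| + 1)) : w = 1 := by
  have hodd := w.2.1.1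
  have hbd : ∀ k : ℤ, 1 ≤ k → k ≤ n → (w : Equiv.Perm ℤ) k ≤ n := fun k h1 h2 =>
    le_trans (le_abs_self _) (w.2.1.abs_le (by rw [abs_of_pos] <;> omega))
  have hstep : ∀ k : ℤ, 1 ≤ k → k + 1 ≤ n →
      (w : Equiv.Perm ℤ) k < (w : Equiv.Perm ℤ) (k + 1) := by
    intro k h1 h2
    have h3 := h ⟨k, Or.inr h1, by rw [abs_of_pos] <;> omega⟩
    simp only [abs_of_pos (show 0 < k by omega)] at h3
    exact lt_of_le_of_ne h3 fun e => by have := (w : Equiv.Perm ℤ).injective e; omega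
  have h2pos : 2 ≤ n → 0 < (w : Equiv.Perm ℤ) 2 := by
    intro hn
    have h3 := h ⟨-1, Or.inl rfl, by simp; omega⟩
    have h4 := hstep 1 le_rfl (by omega)
    simp only [abs_neg, abs_one, hodd 1] at h3
    norm_num at h3 h4
    omega
  have hpos' : ∀ k : ℕ, (k : ℤ) + 2 ≤ n → 0 < (w : Equiv.Perm ℤ) (k + 2) := by
    intro k
    induction k with
    | zero => intro hk; simpa using h2pos (by omega)
    | succ k ih =>
      intro hk
      have h5 := ih (by push_cast at hk; omega)
      have h6 := hstep (k + 2) (by omega) (by push_cast at hk; omega)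
      have h7 : ((k + 1 : ℕ) : ℤ) + 2 = (k : ℤ) + 2 + 1 := by push_cast; ring
      rw [h7]
      omega
  have hone : 1 ≤ n → 0 < (w : Equiv.Perm ℤ) 1 := by
    intro hn
    by_contra hneg
    have hlt : (w : Equiv.Perm ℤ) 1 < 0 :=
      lt_of_le_of_ne (not_lt.1 hneg) (w.2.1.ne_zero (by norm_num))
    have he := w.2.2
    have : (Finset.Icc (1 : ℤ) n).filter (fun x => (w : Equiv.Perm ℤ) x < 0) = {1} := by
      ext x
      simp only [Finset.mem_filter, Finset.mem_Icc, Finset.mem_singleton]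
      constructor
      · rintro ⟨⟨hx1, hx2⟩, hx3⟩
        by_contra hx
        have h8 := hpos' (x - 2).toNat (by omega)
        rw [Int.toNat_of_nonneg (by omega), sub_add_cancel] at h8
        omega
      · rintro rfl
        exact ⟨⟨le_rfl, by omega⟩, hlt⟩
    unfold negCount at he
    rw [this] at he
    revert he
    decide
  have hge : ∀ k : ℕ, (k : ℤ) + 1 ≤ n → (k : ℤ) + 1 ≤ (w : Equiv.Perm ℤ) (k + 1) := by
    intro k
    induction k with
    | zero => intro hk; have := hone (by omega); simp only [Nat.cast_zero, zero_add]; omega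
    | succ k ih =>
      intro hk
      push_cast at hk ⊢
      have h5 := ih (by omega)
      have h6 := hstep (k + 1) (by omega) (by omega)
      omega
  have hle : ∀ k : ℕ, (1 : ℤ) ≤ n - k → (w : Equiv.Perm ℤ) (n - k) ≤ n - k := by
    intro k
    induction k with
    | zero => intro hk; simpa using hbd n (by push_cast at hk; omega) le_rfl
    | succ k ih =>
      intro hk
      push_cast at hk ⊢
      have h5 := ih (by omega)
      have h6 := hstep (n - (k + 1)) (by omega) (by omega)
      rw [show (n : ℤ) - (k + 1) + 1 = n - k by ring] at h6
      omega
  have hfix : ∀ x : ℤ, 1 ≤ x → (w : Equiv.Perm ℤ) x = x := by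
    intro x hx
    by_cases hxn : x ≤ n
    · have h8 := hge (x - 1).toNat (by omega)
      have h9 := hle (n - x).toNat (by omega)
      rw [Int.toNat_of_nonneg (by omega), sub_add_cancel] at h8
      rw [Int.toNat_of_nonneg (by omega), sub_sub_cancel] at h9
      omega
    · exact w.2.1.2 x (by rw [abs_of_pos] <;> omega)
  apply Subtype.ext
  apply Equiv.ext
  intro x
  simp only [Subgroup.coe_one, Equiv.Perm.one_apply]
  rcases lt_trichotomy x 0 with hx | hx | hx
  · have h8 := hfix (-x) (by omega)
    rw [hodd] at h8
    omega
  · rw [hx]; exact w.2.1.zero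
  · exact hfix x (by omega)

theorem exists_word {n : ℕ} (w : W n) : ∃ L : List (Node n), (L.map s).prod = w := by
  suffices H : ∀ (m : ℕ) (w : W n),
      (∑ _k ∈ Finset.Icc (1 : ℤ) n, (n : ℤ) * n) - potential n w ≤ m →
      ∃ L : List (Node n), (L.map s).prod = w from
    H _ w (Int.self_le_toNat _)
  intro m
  induction m with
  | zero =>
    intro w hw
    refine ⟨[], ?_⟩
    symm
    apply eq_one_of_forall_le
    intro i
    by_contra hi
    have h1 := potential_lt w i (not_le.1 hi)
    have h2 := potential_le (w * s i)
    push_cast at hw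
    omega
  | succ m ih =>
    intro w hw
    by_cases h : ∀ i : Node n, (w : Equiv.Perm ℤ) i ≤ (w : Equiv.Perm ℤ) (|(i : ℤ)| + 1)
    · exact ⟨[], (eq_one_of_forall_le w h).symm⟩
    · push Not at h
      obtain ⟨i, hi⟩ := h
      have h1 := potential_lt w i hi
      obtain ⟨L, hL⟩ := ih (w * s i) (by push_cast at hw; omega)
      refine ⟨L ++ [i], ?_⟩
      simp [hL, mul_assoc, s_mul_self]

theorem exists_reduced_word {n : ℕ} (w : W n) :
    ∃ L : List (Node n), L.length = length w ∧ (L.map s).prod = w := by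
  obtain ⟨L, hL⟩ := exists_word w
  exact Nat.sInf_mem (s := {k | ∃ L : List (Node n), L.length = k ∧ (L.map s).prod = w})
    ⟨_, L, rfl, hL⟩

theorem length_le {n : ℕ} {w : W n} (L : List (Node n)) (hL : (L.map s).prod = w) :
    length w ≤ L.length := Nat.sInf_le ⟨L, rfl, hL⟩

theorem length_one {n : ℕ} : length (1 : W n) = 0 := Nat.le_zero.1 (length_le [] rfl)

theorem length_mul_le {n : ℕ} (v w : W n) : length (v * w) ≤ length v + length w := by
  obtain ⟨L, hL, hL'⟩ := exists_reduced_word v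
  obtain ⟨M, hM, hM'⟩ := exists_reduced_word w
  rw [← hL, ← hM, ← List.length_append]
  exact length_le _ (by simp [hL', hM'])

theorem eq_one_of_length_eq_zero {n : ℕ} {w : W n} (h : length w = 0) : w = 1 := by
  obtain ⟨L, hL, hL'⟩ := exists_reduced_word w
  rw [h, List.length_eq_zero_iff] at hL
  simp [← hL', hL]

/-- The right weak order: `v ≤ w` if and only if `l(w) = l(v) + l(v⁻¹ w)`. -/
instance weakOrder (n : ℕ) : PartialOrder (W n) where
  le v w := length w = length v + length (v⁻¹ * w)
  le_refl w := by simp [length_one]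
  le_trans u v w huv hvw := by
    have h1 := length_mul_le u (u⁻¹ * w)
    have h2 := length_mul_le (u⁻¹ * v) (v⁻¹ * w)
    rw [mul_inv_cancel_left] at h1
    rw [mul_assoc, mul_inv_cancel_left] at h2
    omega
  le_antisymm v w hvw hwv := by
    have h : length (v⁻¹ * w) = 0 := by omega
    exact inv_mul_eq_one.1 (eq_one_of_length_eq_zero h)

/-! ### Descents, join-irreducible elements and the sets `R` -/

/-- The value `w(i)` of a signed permutation. -/
def val {n : ℕ} (w : W n) (i : ℤ) : ℤ := (w : Equiv.Perm ℤ) i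

/-- The set of descents of `w`. -/
def des {n : ℕ} (w : W n) : Set (Node n) := {i | w * s i < w}

/-- `w` is a join-irreducible element of type `l`, that is, `l` is its only descent. -/
def IsJirrOfType {n : ℕ} (w : W n) (l : Node n) : Prop :=
  IsJoinIrreducible w ∧ des w = {l}

/-- `R(w) = w([|l| + 1, n])` for a join-irreducible element `w` of type `l`
(and the empty set if `w` is not join-irreducible). -/
def R {n : ℕ} (w : W n) : Set ℤ :=
  {x | ∃ l : Node n, IsJirrOfType w l ∧ x ∈ val w '' Set.Icc (|(l : ℤ)| + 1) n}

/-- `-X`. -/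
def negSet (X : Set ℤ) : Set ℤ := {x | -x ∈ X}

/-- `±X = X ∪ (-X)`. -/
def pm (X : Set ℤ) : Set ℤ := X ∪ negSet X

/-- `a_d = w(d)`. -/
def a {n : ℕ} (w : W n) (d : Node n) : ℤ := val w d

/-- `b_d = w(|d| + 1)`. -/
def b {n : ℕ} (w : W n) (d : Node n) : ℤ := val w (|(d : ℤ)| + 1)

/-- `X_d = w([|d| + 1, n])`. -/
def X {n : ℕ} (w : W n) (d : Node n) : Set ℤ := val w '' Set.Icc (|(d : ℤ)| + 1) n

/-- The condition (A): `a_d + b_d < 0` and `w([1, |d|]) ⊆ ±[a_d, n]`. -/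
def CondA {n : ℕ} (w : W n) (d : Node n) : Prop :=
  a w d + b w d < 0 ∧ val w '' Set.Icc 1 |(d : ℤ)| ⊆ pm (Set.Icc (a w d) n)

open Classical in
/-- The set `R_d`. Note that `a_d ≠ 0` and `a_d + b_d ≠ 0`, so that the two `else` branches of the
inner distinctions are the cases `a_d < 0` and `a_d + b_d < 0`. -/
noncomputable def Rset {n : ℕ} (w : W n) (d : Node n) : Set ℤ :=
  if CondA w d then
    if 0 < a w d then
      {-a w d} ∪ (pm (Set.Icc 1 (a w d - 1)) ∩ X w d) ∪
        (Set.Icc (a w d + 1) (-b w d - 1) \ negSet (X w d)) ∪ Set.Icc (-b w d + 1) n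
    else
      (Set.Icc (-a w d) (-b w d - 1) \ negSet (X w d)) ∪ Set.Icc (-b w d + 1) n
  else
    if 0 < a w d + b w d then
      (Set.Icc (b w d) (a w d - 1) ∩ X w d) ∪ Set.Icc (a w d + 1) n
    else
      (Set.Icc (b w d) (a w d - 1) ∩ X w d) ∪
        (Set.Icc (a w d + 1) (-b w d - 1) \ negSet (X w d)) ∪ Set.Icc (-b w d + 1) n

end TypeD

namespace TypeD

/-! The weak order is inclusion of inversion sets (`le_iff_subset`). Let `d` be a descent of `w`.
Then `w * s d` is obtained from `w` by dropping the single inverted pair `(b w d, a w d)`, so an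
element `x ≤ w` fails to lie below `w * s d` exactly when it inverts that pair (`le_mul_s_iff`).

Suppose that among these `x` there is a least one, `w_d`. The rest is formal. For `e ≠ d` the
element `w * s d` is not below `w * s e`, so `w_e ≤ w * s d`. Everything strictly below `w` lies
below some `w * s d`, while `w_d` does not lie below `w * s d`. Hence the `w_d` join to `w`, and
omitting `w_d` leaves the upper bound `w * s d`. A set `V` with join `w` has a member not below `w *
s d`, and that member lies above `w_d`.

The least element comes from a sort. For a suitable set `S`, arrange the values with `-S` first, `S`
last, and each class increasing; the inversions are then the pairs `x < y` whose class decreases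
(`mem_inversions_of_isSortedBy`). For `S = Rset w d` this element inverts `a w d` and `b w d`.
Conversely, if `v ≤ w` inverts them, all its other prescribed inversions follow by transitivity,
since values in increasing order in `w` stay so in `v` (`val_inv_lt_of_mem_Rset`). Every
join-irreducible element is such a sorted arrangement for its own `R`, whence uniqueness
(`eq_of_R_eq`). -/

variable {n : ℕ}

/-! ### Values of signed permutations -/

theorem val_mul (v w : W n) (x : ℤ) : val (v * w) x = val v (val w x) := rfl

theorem val_one (x : ℤ) : val (1 : W n) x = x := rfl

theorem val_inv_val (w : W n) (x : ℤ) : val w⁻¹ (val w x) = x := by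
  rw [← val_mul, inv_mul_cancel, val_one]

theorem val_val_inv (w : W n) (x : ℤ) : val w (val w⁻¹ x) = x := by
  rw [← val_mul, mul_inv_cancel, val_one]

theorem val_neg (w : W n) (x : ℤ) : val w (-x) = -val w x := w.2.1.1 x

theorem val_zero (w : W n) : val w 0 = 0 := w.2.1.zero

theorem val_inj (w : W n) {x y : ℤ} : val w x = val w y ↔ x = y :=
  (w : Equiv.Perm ℤ).injective.eq_iff

theorem val_ne_zero (w : W n) {x : ℤ} : val w x ≠ 0 ↔ x ≠ 0 := by
  rw [not_iff_not, ← val_zero w, val_inj, val_zero]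

theorem val_add_ne_zero (w : W n) {x y : ℤ} : val w x + val w y ≠ 0 ↔ x + y ≠ 0 := by
  rw [not_iff_not, ← eq_neg_iff_add_eq_zero, ← val_neg, val_inj, eq_neg_iff_add_eq_zero]

theorem val_mem_Icc (w : W n) {x : ℤ} : val w x ∈ Set.Icc (-n : ℤ) n ↔ x ∈ Set.Icc (-n : ℤ) n := by
  have H : ∀ (w : W n) (x : ℤ), x ∈ Set.Icc (-n : ℤ) n → val w x ∈ Set.Icc (-n : ℤ) n :=
    fun w x hx => abs_le.1 (w.2.1.abs_le (abs_le.2 hx))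
  exact ⟨fun h => by simpa only [val_inv_val] using H w⁻¹ _ h, H w x⟩

/-! ### The action of the simple reflections on positions -/

theorem node_cases (i : Node n) :
    ((i : ℤ) = -1 ∧ |(i : ℤ)| = 1 ∧ 2 ≤ (n : ℤ)) ∨
      (1 ≤ (i : ℤ) ∧ |(i : ℤ)| = i ∧ (i : ℤ) + 1 ≤ n) := by
  obtain ⟨i, h | h, hn⟩ := i
  · subst h
    simp only [abs_neg, abs_one] at hn
    exact Or.inl ⟨rfl, by simp, by exact_mod_cast hn⟩
  · rw [abs_of_pos (by omega)] at hn
    exact Or.inr ⟨h, abs_of_pos (show (0 : ℤ) < i by omega), hn⟩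

theorem val_s_neg_one (i : Node n) (hi : (i : ℤ) = -1) (x : ℤ) : val (s i) x =
    if x = 1 then -2 else if x = 2 then -1 else if x = -1 then 2 else if x = -2 then 1 else x := by
  rw [← simplePerm_neg_one, ← hi]; rfl

theorem val_s_pos (i : Node n) (hi : 1 ≤ (i : ℤ)) (x : ℤ) : val (s i) x =
    if x = i then (i : ℤ) + 1 else if x = i + 1 then (i : ℤ) else if x = -i then -((i : ℤ) + 1)
    else if x = -(i + 1) then -(i : ℤ) else x := by
  rw [← simplePerm_pos hi]; rfl

theorem val_s_self (i : Node n) : val (s i) i = |(i : ℤ)| + 1 := by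
  rcases node_cases i with ⟨h, h', -⟩ | ⟨h, h', -⟩
  · rw [val_s_neg_one i h, h', h]; simp
  · rw [val_s_pos i h, h']; simp

theorem val_s_succ (i : Node n) : val (s i) (|(i : ℤ)| + 1) = i := by
  rcases node_cases i with ⟨h, h', -⟩ | ⟨h, h', -⟩
  · rw [val_s_neg_one i h, h', h]; simp
  · rw [val_s_pos i h, h']; simp

theorem val_s_of_ne (i : Node n) {x : ℤ} (h : |x| ≠ |(i : ℤ)|) (h' : |x| ≠ |(i : ℤ)| + 1) :
    val (s i) x = x := by
  rcases node_cases i with ⟨hi, h1, -⟩ | ⟨hi, h1, -⟩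
  · rw [val_s_neg_one i hi]
    rcases abs_cases x with hx | hx <;> split_ifs <;> omega
  · rw [val_s_pos i hi]
    rcases abs_cases x with hx | hx <;> split_ifs <;> omega

theorem s_inv (i : Node n) : (s i)⁻¹ = s i := inv_eq_of_mul_eq_one_left (s_mul_self i)

/-- The two exchanged positions are neighbours once opposite positions are not compared. That
exclusion is needed: `s_{-1}` sends `-1 < 1` to `2 > -2`. -/
theorem val_s_lt (i : Node n) {x y : ℤ} (hx : x ≠ 0) (hy : y ≠ 0) (hxy : x + y ≠ 0) (h : x < y) :
    val (s i) x < val (s i) y ∨ (x = i ∧ y = |(i : ℤ)| + 1) ∨ (x = -(|(i : ℤ)| + 1) ∧ y = -i) := by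
  rcases node_cases i with ⟨hi, h1, -⟩ | ⟨hi, h1, -⟩
  · rw [val_s_neg_one i hi, val_s_neg_one i hi]
    split_ifs <;> omega
  · rw [val_s_pos i hi, val_s_pos i hi]
    split_ifs <;> omega

/-! ### Inversion sets -/

/-- The left inversion set: pairs of values `x < y` such that `y` stands to the left of `x`. Every
reflection is counted twice, as `(x, y)` and as `(-y, -x)`. -/
noncomputable def inversions (w : W n) : Finset (ℤ × ℤ) :=
  (Finset.Icc (-n : ℤ) n ×ˢ Finset.Icc (-n : ℤ) n).filter fun p =>
    p.1 ≠ 0 ∧ p.2 ≠ 0 ∧ p.1 + p.2 ≠ 0 ∧ p.1 < p.2 ∧ val w⁻¹ p.2 < val w⁻¹ p.1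

theorem mem_inversions {w : W n} {x y : ℤ} : (x, y) ∈ inversions w ↔
    (x ∈ Set.Icc (-n : ℤ) n ∧ y ∈ Set.Icc (-n : ℤ) n) ∧
      x ≠ 0 ∧ y ≠ 0 ∧ x + y ≠ 0 ∧ x < y ∧ val w⁻¹ y < val w⁻¹ x := by
  simp [inversions, Set.mem_Icc]

/-- The pair of values `(x, y)` together with `(-y, -x)`. -/
def rootPair (x y : ℤ) : Finset (ℤ × ℤ) := {(x, y), (-y, -x)}

theorem rootPair_neg (x y : ℤ) : rootPair (-y) (-x) = rootPair x y := by
  simp [rootPair, Finset.pair_comm]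

theorem mem_inversions_neg {w : W n} {x y : ℤ} (h : (x, y) ∈ inversions w) :
    (-y, -x) ∈ inversions w := by
  rw [mem_inversions] at *
  simp only [val_neg, Set.mem_Icc] at *
  omega

theorem rootPair_subset {w : W n} {x y : ℤ} : rootPair x y ⊆ inversions w ↔
    (x, y) ∈ inversions w := by
  simp only [rootPair, Finset.insert_subset_iff, Finset.singleton_subset_iff]
  exact ⟨fun h => h.1, fun h => ⟨h, mem_inversions_neg h⟩⟩

/-- The values of `w` at the two positions that `s i` exchanges. -/
def rootsAt (w : W n) (i : Node n) : Finset (ℤ × ℤ) :=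
  rootPair (val w i) (val w (|(i : ℤ)| + 1))

/-- `i` is an ascent of `w`. -/
def IsAscent (w : W n) (i : Node n) : Prop := val w i < val w (|(i : ℤ)| + 1)

theorem not_isAscent_iff {w : W n} {i : Node n} :
    ¬ IsAscent w i ↔ val w (|(i : ℤ)| + 1) < val w i := by
  have h : val w i ≠ val w (|(i : ℤ)| + 1) := by
    rw [Ne, val_inj]
    rcases node_cases i with h | h <;> omega
  unfold IsAscent
  omega

theorem isAscent_mul_s {w : W n} {i : Node n} : IsAscent (w * s i) i ↔ ¬ IsAscent w i := by
  rw [not_isAscent_iff, IsAscent, val_mul, val_mul, val_s_self, val_s_succ]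

/-- Written in positions of `w`, the claim is `val_s_lt`: `s i` changes the relative order of one
pair of positions and of its negative only. -/
theorem inversions_mul_s {w : W n} {i : Node n} (h : IsAscent w i) :
    inversions (w * s i) = inversions w ∪ rootsAt w i := by
  ext ⟨x, y⟩
  obtain ⟨P, rfl⟩ : ∃ P, val w P = x := ⟨_, val_val_inv w x⟩
  obtain ⟨Q, rfl⟩ : ∃ Q, val w Q = y := ⟨_, val_val_inv w y⟩
  have hi := node_cases i
  have h1 := val_s_self i
  have h2 := val_s_succ i
  have h1' := val_neg (s i) i
  have h2' := val_neg (s i) (|(i : ℤ)| + 1)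
  simp only [Finset.mem_union, mem_inversions, mul_inv_rev, val_mul, val_inv_val, s_inv, rootsAt,
    rootPair, Finset.mem_insert, Finset.mem_singleton, Prod.mk.injEq, ← val_neg, val_inj,
    val_ne_zero, val_add_ne_zero, val_mem_Icc]
  unfold IsAscent at h
  constructor
  · rintro ⟨hr, h3, h4, h5, h6, h7⟩
    by_cases h8 : Q < P
    · exact Or.inl ⟨hr, h3, h4, h5, h6, h8⟩
    · right
      have : P ≠ Q := fun e => by rw [e] at h6; exact lt_irrefl _ h6
      rcases val_s_lt i h3 h4 h5 (by omega) with h9 | h9 | h9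
      · omega
      · exact Or.inl h9
      · exact Or.inr h9
  · rintro (⟨hr, h3, h4, h5, h6, h7⟩ | ⟨rfl, rfl⟩ | ⟨rfl, rfl⟩)
    · refine ⟨hr, h3, h4, h5, h6, ?_⟩
      rcases val_s_lt i h4 h3 (by omega) h7 with h9 | h9 | h9
      · exact h9
      · rw [h9.1, h9.2] at h6; omega
      · rw [h9.1, h9.2, val_neg, val_neg] at h6; omega
    · simp only [Set.mem_Icc]
      omega
    · rw [val_neg (s i), val_neg (s i), h1, h2, val_neg w, val_neg w]
      simp only [Set.mem_Icc]
      omega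

theorem disjoint_rootsAt (w : W n) (i : Node n) :
    Disjoint (inversions w) (rootsAt w i) := by
  rw [Finset.disjoint_right]
  rintro ⟨x, y⟩ hxy
  have hi := node_cases i
  simp only [rootsAt, rootPair, Finset.mem_insert, Finset.mem_singleton, Prod.mk.injEq] at hxy
  rcases hxy with ⟨rfl, rfl⟩ | ⟨rfl, rfl⟩ <;> rw [mem_inversions] <;>
    simp only [val_neg, val_inv_val] <;> omega

theorem card_rootsAt (w : W n) (i : Node n) : (rootsAt w i).card = 2 := by
  refine Finset.card_pair fun he => ?_
  have h1 := congrArg Prod.fst he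
  simp only [← val_neg, val_inj] at h1
  rcases node_cases i with h | h <;> omega

theorem card_inversions_mul_s {w : W n} {i : Node n} (h : IsAscent w i) :
    (inversions (w * s i)).card = (inversions w).card + 2 := by
  rw [inversions_mul_s h, Finset.card_union_of_disjoint (disjoint_rootsAt w i), card_rootsAt]

theorem mul_s_mul_s (w : W n) (i : Node n) : w * s i * s i = w := by
  rw [mul_assoc, s_mul_self, mul_one]

theorem card_inversions_mul_s_of_not {w : W n} {i : Node n} (h : ¬ IsAscent w i) :
    (inversions (w * s i)).card + 2 = (inversions w).card := by
  have := card_inversions_mul_s (isAscent_mul_s.2 h)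
  rw [mul_s_mul_s] at this
  exact this.symm

/-- Each letter changes the number of inversions by `±2`. Equality therefore forces every letter to
be an ascent, and ascents only add inversions. -/
theorem card_inversions_mul_prod_le (v : W n) (L : List (Node n)) :
    (inversions (v * (L.map s).prod)).card ≤ (inversions v).card + 2 * L.length ∧
      ((inversions (v * (L.map s).prod)).card = (inversions v).card + 2 * L.length →
        inversions v ⊆ inversions (v * (L.map s).prod)) := by
  induction L using List.reverseRecOn with
  | nil => simp
  | append_singleton L i ih =>
    rw [List.map_append, List.prod_append, ← mul_assoc, List.length_append]
    simp only [List.map_cons, List.map_nil, List.prod_singleton, List.length_singleton]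
    by_cases h : IsAscent (v * (L.map s).prod) i
    · rw [card_inversions_mul_s h]
      refine ⟨by omega, fun he => (ih.2 (by omega)).trans ?_⟩
      rw [inversions_mul_s h]
      exact Finset.subset_union_left
    · have := card_inversions_mul_s_of_not h
      exact ⟨by omega, fun he => by omega⟩

theorem inversions_one : inversions (1 : W n) = ∅ := by
  rw [Finset.eq_empty_iff_forall_notMem]
  rintro ⟨x, y⟩
  rw [mem_inversions, inv_one, val_one, val_one]
  omega

theorem exists_not_isAscent {w : W n} (h : w ≠ 1) : ∃ i, ¬ IsAscent w i := by
  by_contra! hw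
  exact h (eq_one_of_forall_le w fun i => le_of_lt (hw i))

theorem two_mul_length (w : W n) : 2 * length w = (inversions w).card := by
  apply le_antisymm
  · induction hk : (inversions w).card using Nat.strong_induction_on generalizing w with
    | _ k ih =>
      by_cases h : w = 1
      · simp [h, length_one]
      · obtain ⟨i, hi⟩ := exists_not_isAscent h
        have h1 := card_inversions_mul_s_of_not hi
        have h2 := ih _ (by omega) (w * s i) rfl
        have h3 := length_mul_le (w * s i) (s i)
        have h4 : length (s i) ≤ 1 := length_le [i] (by simp)
        rw [mul_s_mul_s] at h3
        omega
  · obtain ⟨L, hL, rfl⟩ := exists_reduced_word w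
    have := (card_inversions_mul_prod_le 1 L).1
    rw [inversions_one, one_mul] at this
    simp only [Finset.card_empty] at this
    omega

theorem length_mul_s {w : W n} {i : Node n} (h : IsAscent w i) :
    length (w * s i) = length w + 1 := by
  have h1 := card_inversions_mul_s h
  rw [← two_mul_length, ← two_mul_length] at h1
  omega

/-! ### The weak order as inclusion of inversion sets -/

theorem le_iff_length {v w : W n} : v ≤ w ↔ length w = length v + length (v⁻¹ * w) := Iff.rfl

theorem le_mul_s {w : W n} {i : Node n} (h : IsAscent w i) : w ≤ w * s i := by
  rw [le_iff_length, inv_mul_cancel_left]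
  have h1 := length_mul_s h
  have h2 := length_mul_le w (s i)
  have h4 : length (s i) ≤ 1 := length_le [i] (by simp)
  omega

/-- A descent of `w⁻¹ * v` marks two neighbouring values of `v` that stand in the opposite order in
`w`. The inclusion rules out that `v` already inverts them, so `v` can be moved up there without
leaving `inversions w`. -/
theorem exists_ascent_of_subset {v w : W n} (h : inversions v ⊆ inversions w) (hne : v ≠ w) :
    ∃ i, IsAscent v i ∧ inversions (v * s i) ⊆ inversions w := by
  obtain ⟨i, hi⟩ := exists_not_isAscent (w := w⁻¹ * v) (fun h => hne (inv_mul_eq_one.1 h).symm)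
  rw [not_isAscent_iff, val_mul, val_mul] at hi
  have hc := node_cases i
  have hA : IsAscent v i := by
    by_contra hd
    rw [not_isAscent_iff] at hd
    have h1 : (val v (|(i : ℤ)| + 1), val v i) ∈ inversions v := by
      simp only [mem_inversions, val_inv_val, val_ne_zero, val_add_ne_zero, val_mem_Icc]
      simp only [Set.mem_Icc]
      omega
    have h2 := mem_inversions.1 (h h1)
    omega
  refine ⟨i, hA, ?_⟩
  rw [inversions_mul_s hA]
  refine Finset.union_subset h (rootPair_subset.2 ?_)
  unfold IsAscent at hA
  simp only [mem_inversions, val_ne_zero, val_add_ne_zero, val_mem_Icc]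
  simp only [Set.mem_Icc]
  omega

/-- The weak order is the inclusion order of inversion sets. -/
theorem le_iff_subset {v w : W n} : v ≤ w ↔ inversions v ⊆ inversions w := by
  constructor
  · intro h
    obtain ⟨L, hL, hL'⟩ := exists_reduced_word (v⁻¹ * w)
    have h1 := (card_inversions_mul_prod_le v L).2
    rw [hL', mul_inv_cancel_left, hL] at h1
    apply h1
    rw [le_iff_length] at h
    rw [← two_mul_length, ← two_mul_length, h]
    ring
  · intro h
    induction hk : (inversions w).card - (inversions v).card using Nat.strong_induction_on
      generalizing v with
    | _ k ih =>
      by_cases hne : v = w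
      · exact hne.le
      · obtain ⟨i, hi, hi'⟩ := exists_ascent_of_subset h hne
        have h1 := card_inversions_mul_s hi
        have h2 := Finset.card_le_card hi'
        exact (le_mul_s hi).trans (ih _ (by omega) hi' rfl)

theorem inversions_injective : Function.Injective (inversions (n := n)) := fun _ _ h =>
  le_antisymm (le_iff_subset.2 h.le) (le_iff_subset.2 h.ge)

theorem one_le (w : W n) : 1 ≤ w := by
  rw [le_iff_subset, inversions_one]
  exact Finset.empty_subset _

theorem lt_mul_s {w : W n} {i : Node n} (h : IsAscent w i) : w < w * s i := by
  refine lt_of_le_of_ne (le_mul_s h) fun e => ?_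
  have := length_mul_s h
  rw [← e] at this
  omega

theorem mem_des {w : W n} {i : Node n} : i ∈ des w ↔ ¬ IsAscent w i := by
  constructor
  · exact fun h h' => lt_asymm h (lt_mul_s h')
  · intro h
    have := lt_mul_s (isAscent_mul_s.2 h)
    rwa [mul_s_mul_s] at this

/-- Dual to `exists_ascent_of_subset`: a descent of `v⁻¹ * w` marks neighbouring values of `w`
ordered oppositely in `v`. By inclusion they are inverted in `w` and not in `v`. -/
theorem exists_le_mul_s {v w : W n} (h : v < w) : ∃ i ∈ des w, v ≤ w * s i := by
  obtain ⟨i, hi⟩ := exists_not_isAscent (w := v⁻¹ * w) (fun h' => h.ne (inv_mul_eq_one.1 h'))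
  rw [not_isAscent_iff, val_mul, val_mul] at hi
  have hc := node_cases i
  have hs := le_iff_subset.1 h.le
  have hd : ¬ IsAscent w i := by
    intro hA
    unfold IsAscent at hA
    have h1 : (val w i, val w (|(i : ℤ)| + 1)) ∈ inversions v := by
      simp only [mem_inversions, val_ne_zero, val_add_ne_zero, val_mem_Icc]
      simp only [Set.mem_Icc]
      omega
    have h2 := mem_inversions.1 (hs h1)
    simp only [val_inv_val] at h2
    omega
  refine ⟨i, mem_des.2 hd, ?_⟩
  rw [le_iff_subset]
  have h1 := inversions_mul_s (isAscent_mul_s.2 hd)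
  rw [mul_s_mul_s, rootsAt, val_mul, val_mul, val_s_self, val_s_succ] at h1
  rintro ⟨x, y⟩ hxy
  have h2 := hs hxy
  rw [h1, Finset.mem_union] at h2
  refine h2.resolve_right fun h3 => ?_
  have h4 := mem_inversions.1 hxy
  simp only [rootPair, Finset.mem_insert, Finset.mem_singleton, Prod.mk.injEq] at h3
  rcases h3 with ⟨rfl, rfl⟩ | ⟨rfl, rfl⟩
  · omega
  · simp only [val_neg] at h4
    omega

/-- `w s_i` is the largest element below `w` whose inversion set omits the reflection of `i`. -/
theorem le_mul_s_iff {v w : W n} {i : Node n} (hi : i ∈ des w) (h : v ≤ w) :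
    v ≤ w * s i ↔ (val w (|(i : ℤ)| + 1), val w i) ∉ inversions v := by
  have hd := mem_des.1 hi
  have h0 := isAscent_mul_s.2 hd
  have h1 := inversions_mul_s h0
  have h2 := disjoint_rootsAt (w * s i) i
  rw [rootsAt, val_mul, val_mul, val_s_self, val_s_succ] at h1 h2
  rw [mul_s_mul_s] at h1
  rw [le_iff_subset] at *
  constructor
  · exact fun h3 h4 => Finset.disjoint_left.1 h2 (h3 h4) (by simp [rootPair])
  · intro h3 p hp
    have h5 := h hp
    rw [h1, Finset.mem_union] at h5
    refine h5.resolve_right fun h6 => h3 ?_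
    simp only [rootPair, Finset.mem_insert, Finset.mem_singleton] at h6
    rcases h6 with rfl | rfl
    · exact hp
    · simpa using mem_inversions_neg hp

/-! ### Joins of pairs that are bounded above -/

/-- The nodes are joined in the Dynkin diagram (this includes `-1` and `2`), so the join is the
braid word, with three new roots. -/
theorem isLUB_mul_s_adjacent {z : W n} {i j : Node n} (hij : (j : ℤ) = |(i : ℤ)| + 1)
    (hi : IsAscent z i) (hj : IsAscent z j) :
    IsLUB {z * s i, z * s j} (z * s i * s j * s i) := by
  have hci := node_cases i
  have hcj := node_cases j
  have ei := val_s_self i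
  have ei' := val_s_succ i
  have ej := val_s_self j
  have ej' := val_s_succ j
  have e1 : val (s i) (|(j : ℤ)| + 1) = |(j : ℤ)| + 1 :=
    val_s_of_ne i (by rw [abs_of_pos] <;> omega) (by rw [abs_of_pos] <;> omega)
  have e2 : val (s j) i = i := val_s_of_ne j (by omega) (by omega)
  have h2 : IsAscent (z * s i) j := by
    unfold IsAscent at *
    rw [val_mul, val_mul, e1, hij, ei']
    rw [hij] at hj
    omega
  have h3 : IsAscent (z * s i * s j) i := by
    unfold IsAscent at *
    rw [val_mul, val_mul, val_mul, val_mul, e2, ei, ← hij, ej, e1]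
    exact hj
  have hr : inversions (z * s i * s j * s i) = inversions z ∪
      rootPair (val z i) (val z j) ∪ rootPair (val z i) (val z (|(j : ℤ)| + 1)) ∪
      rootPair (val z j) (val z (|(j : ℤ)| + 1)) := by
    rw [inversions_mul_s h3, inversions_mul_s h2, inversions_mul_s hi]
    simp only [rootsAt, val_mul, e1, e2, ← hij, ei, ej]
    rw [hij, ei']
  have hzj := inversions_mul_s hj
  have hzi := inversions_mul_s hi
  simp only [rootsAt, ← hij] at hzi hzj
  constructor
  · simp only [mem_upperBounds, Set.mem_insert_iff, Set.mem_singleton_iff, forall_eq_or_imp,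
      forall_eq, le_iff_subset, hr, hzi, hzj]
    exact ⟨by grind, by grind⟩
  · intro v hv
    simp only [mem_upperBounds, Set.mem_insert_iff, Set.mem_singleton_iff, forall_eq_or_imp,
      forall_eq, le_iff_subset, hzi, hzj, Finset.union_subset_iff, rootPair_subset] at hv
    simp only [le_iff_subset, hr, Finset.union_subset_iff, rootPair_subset]
    -- The third root is the sum of the two others; its inversion follows by transitivity of the
    -- order of positions.
    refine ⟨⟨hv.1, ?_⟩, hv.2.2⟩
    have h4 := mem_inversions.1 hv.1.2
    have h5 := mem_inversions.1 hv.2.2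
    rw [mem_inversions]
    simp only [val_ne_zero, val_add_ne_zero, val_mem_Icc] at *
    refine ⟨⟨h4.1.1, h5.1.2⟩, ?_⟩
    omega

theorem isLUB_mul_s_comm {z : W n} {i j : Node n} (hij : i ≠ j) (hij' : (j : ℤ) ≠ |(i : ℤ)| + 1)
    (hji : (i : ℤ) ≠ |(j : ℤ)| + 1) (hi : IsAscent z i) (hj : IsAscent z j) :
    IsLUB {z * s i, z * s j} (z * s i * s j) := by
  have hci := node_cases i
  have hcj := node_cases j
  have hne : (i : ℤ) ≠ j := fun h => hij (Subtype.ext h)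
  -- The second alternative occurs for the nodes `1` and `-1`: there `s i` swaps the two positions
  -- of `j` up to sign, which leaves the root pair unchanged.
  have key : (val (s i) j = j ∧ val (s i) (|(j : ℤ)| + 1) = |(j : ℤ)| + 1) ∨
      (val (s i) j = -(|(j : ℤ)| + 1) ∧ val (s i) (|(j : ℤ)| + 1) = -j) := by
    rcases hci with h | h
    · simp only [val_s_neg_one i h.1]
      split_ifs <;> omega
    · simp only [val_s_pos i h.1]
      split_ifs <;> omega
  have hr : rootsAt (z * s i) j = rootsAt z j := by
    unfold rootsAt
    rw [val_mul, val_mul]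
    rcases key with ⟨h1, h2⟩ | ⟨h1, h2⟩ <;> rw [h1, h2]
    rw [val_neg, val_neg, rootPair_neg]
  have h2 : IsAscent (z * s i) j := by
    unfold IsAscent at *
    rw [val_mul, val_mul]
    rcases key with ⟨h1, h2⟩ | ⟨h1, h2⟩ <;> rw [h1, h2]
    · exact hj
    · rw [val_neg, val_neg]; omega
  have hr' := inversions_mul_s h2
  rw [hr, inversions_mul_s hi] at hr'
  simp only [IsLUB, IsLeast, mem_lowerBounds, mem_upperBounds, Set.mem_insert_iff,
    Set.mem_singleton_iff, forall_eq_or_imp, forall_eq, le_iff_subset, hr', inversions_mul_s hi,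
    inversions_mul_s hj]
  exact ⟨⟨by grind, by grind⟩, fun v hv => by grind⟩

theorem exists_isLUB_mul_s {z : W n} {i j : Node n} (hi : IsAscent z i) (hj : IsAscent z j) :
    ∃ r, IsLUB {z * s i, z * s j} r := by
  by_cases h : i = j
  · subst h
    exact ⟨z * s i, by simp⟩
  by_cases h1 : (j : ℤ) = |(i : ℤ)| + 1
  · exact ⟨_, isLUB_mul_s_adjacent h1 hi hj⟩
  by_cases h2 : (i : ℤ) = |(j : ℤ)| + 1
  · rw [Set.pair_comm]
    exact ⟨_, isLUB_mul_s_adjacent h2 hj hi⟩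
  exact ⟨_, isLUB_mul_s_comm h h1 h2 hi hj⟩

theorem exists_mul_s_le {v w : W n} (h : v < w) : ∃ i, IsAscent v i ∧ v * s i ≤ w := by
  obtain ⟨i, hi, hi'⟩ := exists_ascent_of_subset (le_iff_subset.1 h.le) h.ne
  exact ⟨i, hi, le_iff_subset.2 hi'⟩

theorem length_le_of_le {v w : W n} (h : v ≤ w) : length v ≤ length w := by
  rw [le_iff_length] at h
  omega

theorem eq_of_le_of_length_le {v w : W n} (h : v ≤ w) (h' : length w ≤ length v) : v = w := by
  rw [le_iff_length] at h
  exact inv_mul_eq_one.1 (eq_one_of_length_eq_zero (by omega))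

theorem isLUB_pair_iff {p q r : W n} :
    IsLUB {p, q} r ↔ p ≤ r ∧ q ≤ r ∧ ∀ u, p ≤ u → q ≤ u → r ≤ u := by
  simp [IsLUB, IsLeast, mem_lowerBounds, and_assoc]

/-- Local joins give global ones: it suffices to join two covers of a common lower bound, by
induction on the distance from that bound to `u`. -/
theorem exists_isLUB_pair_of_le {z p q u : W n} (hzp : z ≤ p) (hzq : z ≤ q) (hp : p ≤ u)
    (hq : q ≤ u) : ∃ r, IsLUB {p, q} r := by
  induction hk : length u - length z using Nat.strong_induction_on generalizing z p q with
  | _ k ih =>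
    rcases hzp.eq_or_lt with rfl | hzp
    · exact ⟨q, isLUB_pair_iff.2 ⟨hzq, le_rfl, fun _ _ h => h⟩⟩
    rcases hzq.eq_or_lt with rfl | hzq
    · exact ⟨p, isLUB_pair_iff.2 ⟨le_rfl, hzp.le, fun _ h _ => h⟩⟩
    obtain ⟨i, hi, hip⟩ := exists_mul_s_le hzp
    obtain ⟨j, hj, hjq⟩ := exists_mul_s_le hzq
    have hli := length_mul_s hi
    have hlj := length_mul_s hj
    have hlu := length_le_of_le (hip.trans hp)
    obtain ⟨r, hr⟩ := exists_isLUB_mul_s hi hj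
    rw [isLUB_pair_iff] at hr
    have hru := hr.2.2 u (hip.trans hp) (hjq.trans hq)
    -- `r` joins the covers `z * s i` and `z * s j`. Then `t = p ∨ r` is formed above `z * s i` and
    -- `m = t ∨ q` above `z * s j`, both at smaller distance from `u`.
    obtain ⟨t, ht⟩ := ih _ (by omega) hip hr.1 hp hru rfl
    rw [isLUB_pair_iff] at ht
    obtain ⟨m, hm⟩ := ih _ (by omega) (hr.2.1.trans ht.2.1) hjq (ht.2.2 u hp hru) hq rfl
    rw [isLUB_pair_iff] at hm
    exact ⟨m, isLUB_pair_iff.2 ⟨ht.1.trans hm.1, hm.2.1, fun x hx hx' =>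
      hm.2.2 x (ht.2.2 x hx (hr.2.2 x (hip.trans hx) (hjq.trans hx'))) hx'⟩⟩

/-- The join of all the elements in `U` equals `w` as soon as `U` has no upper bound of the form
`w s_i` below `w`. -/
theorem isLUB_of_forall_des {w : W n} {U : Set (W n)} (hU : w ∈ upperBounds U)
    (h : ∀ i ∈ des w, ∃ v ∈ U, ¬ v ≤ w * s i) : IsLUB U w := by
  refine ⟨hU, fun u hu => ?_⟩
  -- `m` stands in for the meet of `w` and `u`. Maximal length suffices: for `v ∈ U` the join of `v`
  -- and `m` is again a common lower bound, hence equals `m`.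
  obtain ⟨m, ⟨hmw, hmu⟩, hmax⟩ : ∃ m, (m ≤ w ∧ m ≤ u) ∧
      ∀ x, x ≤ w ∧ x ≤ u → length x ≤ length m := by
    have hb : ∃ k, ∃ m, m ≤ w ∧ m ≤ u ∧ length w - length m = k :=
      ⟨_, 1, one_le w, one_le u, rfl⟩
    classical
    obtain ⟨m, h1, h2, h3⟩ := Nat.find_spec hb
    refine ⟨m, ⟨h1, h2⟩, fun x hx => ?_⟩
    have h4 := Nat.find_min' hb ⟨x, hx.1, hx.2, rfl⟩
    have h5 := length_le_of_le hx.1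
    have h6 := length_le_of_le h1
    omega
  have hUm : ∀ v ∈ U, v ≤ m := by
    intro v hv
    obtain ⟨r, hr⟩ := exists_isLUB_pair_of_le (one_le v) (one_le m) (hU hv) hmw
    rw [isLUB_pair_iff] at hr
    have h1 := hmax r ⟨hr.2.2 w (hU hv) hmw, hr.2.2 u (hu hv) hmu⟩
    rw [eq_of_le_of_length_le hr.2.1 h1]
    exact hr.1
  rcases hmw.eq_or_lt with rfl | hlt
  · exact hmu
  · obtain ⟨i, hi, hmi⟩ := exists_le_mul_s hlt
    obtain ⟨v, hv, hv'⟩ := h i hi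
    exact absurd ((hUm v hv).trans hmi) hv'

/-! ### Join-irreducible elements and descents -/

theorem isJoinIrreducible_of_des {u : W n} {i : Node n} (h : des u = {i}) :
    IsJoinIrreducible u := by
  have hi : u * s i < u := by
    have : i ∈ des u := by rw [h]; rfl
    exact this
  have key : ∀ y, y ≤ u → y ≠ u → y ≤ u * s i := by
    intro y hy hne
    obtain ⟨j, hj, hy'⟩ := exists_le_mul_s (lt_of_le_of_ne hy hne)
    rw [h, Set.mem_singleton_iff] at hj
    rwa [← hj]
  refine ⟨fun hb => hi.not_ge (hb _), fun y z hyz => ?_⟩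
  rw [isLUB_pair_iff] at hyz
  by_contra! hne
  exact hi.not_ge (hyz.2.2 _ (key y hyz.1 hne.1) (key z hyz.2.1 hne.2))

/-- Both elements have length one less than `u`, so comparable means equal. -/
theorem mul_s_le_mul_s {u : W n} {t k : Node n} (ht : t ∈ des u) (hk : k ∈ des u)
    (hle : u * s t ≤ u * s k) : t = k := by
  have h1 := length_mul_s (isAscent_mul_s.2 (mem_des.1 ht))
  have h2 := length_mul_s (isAscent_mul_s.2 (mem_des.1 hk))
  rw [mul_s_mul_s] at h1 h2
  have h3 := mul_left_cancel (eq_of_le_of_length_le hle (by omega))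
  have h4 := val_s_self t
  have h5 := val_s_succ t
  rw [h3] at h4 h5
  have ht := node_cases t
  apply Subtype.ext
  rcases node_cases k with hk | hk
  · rw [val_s_neg_one k hk.1] at h4 h5
    split_ifs at h4 h5 <;> omega
  · rw [val_s_pos k hk.1] at h4 h5
    split_ifs at h4 h5 <;> omega

/-- With two descents `i` and `j`, `u` would be the join of the smaller elements `u * s i` and `u *
s j`. -/
theorem exists_des_eq_singleton {u : W n} (h : IsJoinIrreducible u) : ∃ i, des u = {i} := by
  have hne : u ≠ 1 := fun e => h.1 (by rw [e]; exact one_le)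
  obtain ⟨i, hi⟩ := exists_not_isAscent hne
  rw [← mem_des] at hi
  refine ⟨i, Set.eq_singleton_iff_unique_mem.2 ⟨hi, fun j hj => ?_⟩⟩
  by_contra hji
  have hiu : u * s i < u := hi
  have hju : u * s j < u := hj
  have hlub : IsLUB {u * s i, u * s j} u := by
    refine isLUB_of_forall_des ?_ fun k hk => ?_
    · simp only [mem_upperBounds, Set.mem_insert_iff, Set.mem_singleton_iff, forall_eq_or_imp,
        forall_eq]
      exact ⟨hiu.le, hju.le⟩
    · by_cases hik : i = k
      · exact ⟨_, Or.inr rfl, fun hle => hji ((mul_s_le_mul_s hj hk hle).trans hik.symm)⟩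
      · exact ⟨_, Or.inl rfl, fun hle => hik (mul_s_le_mul_s hi hk hle)⟩
  rcases h.2 _ _ hlub with h1 | h1
  · exact hiu.ne h1
  · exact hju.ne h1

/-! ### Sorting by a key -/

/-- Positivity on simple roots gives positivity on all positive roots. Here `h 1` may be negative,
but `hbase` makes the sum of `h` at two distinct positive positions positive; this handles pairs of
mixed sign. -/
theorem lt_of_isAscent_chain {h : ℤ → ℤ} (hn : 2 ≤ n) (hodd : ∀ x, h (-x) = -h x)
    (hstep : ∀ j : ℤ, 1 ≤ j → j + 1 ≤ n → h j < h (j + 1)) (hbase : -h 1 < h 2) {P Q : ℤ}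
    (hP : P ≠ 0) (hQ : Q ≠ 0) (hPQ : P + Q ≠ 0) (hlt : P < Q) (hPn : -n ≤ P) (hQn : Q ≤ n) :
    h P < h Q := by
  have mono : ∀ j : ℤ, 1 ≤ j → ∀ k : ℤ, j ≤ k → k ≤ n → h j ≤ h k := by
    intro j hj k hjk
    induction k, hjk using Int.leInduction with
    | base => exact fun _ => le_rfl
    | succ k hk ih => exact fun hkn => (ih (by omega)).trans (hstep k (by omega) hkn).le
  have smono : ∀ j : ℤ, 1 ≤ j → ∀ k : ℤ, j < k → k ≤ n → h j < h k := fun j hj k hjk hk =>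
    (hstep j hj (by omega)).trans_le (mono _ (by omega) _ (by omega) hk)
  have h12 := hstep 1 le_rfl (by omega)
  norm_num at h12
  have hsum : ∀ j k : ℤ, 1 ≤ j → j < k → k ≤ n → 0 < h j + h k := by
    intro j k hj hjk hk
    have h2 := mono 2 (by omega) k (by omega) hk
    have h1 := mono 1 le_rfl j hj (by omega)
    omega
  rcases lt_or_gt_of_ne hP with h1 | h1 <;> rcases lt_or_gt_of_ne hQ with h2 | h2
  · have := smono (-Q) (by omega) (-P) (by omega) (by omega)
    rw [hodd, hodd] at this
    omega
  · have h3 := hodd P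
    rcases lt_or_gt_of_ne (show -P ≠ Q by omega) with h4 | h4
    · have := hsum (-P) Q (by omega) h4 (by omega)
      omega
    · have := hsum Q (-P) (by omega) h4 (by omega)
      omega
  · omega
  · exact smono P (by omega) Q hlt hQn

/-- The keys of the values of `g` ascend at every node. -/
def IsSortedBy (K : ℤ → ℤ) (g : W n) : Prop :=
  ∀ i : Node n, K (val g i) < K (val g (|(i : ℤ)| + 1))

theorem IsSortedBy.lt {K : ℤ → ℤ} (hodd : ∀ x, K (-x) = -K x) {g : W n} (hn : 2 ≤ n)
    (hg : IsSortedBy K g) {P Q : ℤ} (hP : P ≠ 0) (hQ : Q ≠ 0) (hPQ : P + Q ≠ 0) (hlt : P < Q)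
    (hPn : -n ≤ P) (hQn : Q ≤ n) : K (val g P) < K (val g Q) := by
  refine lt_of_isAscent_chain (h := fun x => K (val g x)) hn (fun x => ?_) (fun j hj hjn => ?_) ?_
    hP hQ hPQ hlt hPn hQn
  · rw [val_neg, hodd]
  · have := hg ⟨j, Or.inr hj, by rw [abs_of_pos] <;> omega⟩
    simpa only [abs_of_pos (show 0 < j by omega)] using this
  · have := hg ⟨-1, Or.inl rfl, by simp; omega⟩
    simp only [val_neg, hodd, abs_neg, abs_one] at this
    simpa using this

instance : Finite (W n) := by
  refine Finite.of_injective (β := Finset.powerset (Finset.Icc (-n : ℤ) n ×ˢ Finset.Icc (-n : ℤ) n))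
    (fun w => ⟨inversions w, Finset.mem_powerset.2 (Finset.filter_subset _ _)⟩) fun v w h => ?_
  exact inversions_injective (congrArg Subtype.val h)

theorem sum_lt_sum_of_pair {S : Finset ℤ} {a b : ℤ} (hab : a ≠ b) (ha : a ∈ S) (hb : b ∈ S)
    {f g : ℤ → ℤ} (hfg : ∀ x ∈ S, x ≠ a → x ≠ b → f x = g x) (hlt : f a + f b < g a + g b) :
    ∑ k ∈ S, f k < ∑ k ∈ S, g k := by
  have hb' : b ∈ S.erase a := Finset.mem_erase.2 ⟨hab.symm, hb⟩
  rw [← Finset.add_sum_erase _ f ha, ← Finset.add_sum_erase _ f hb',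
    ← Finset.add_sum_erase _ g ha, ← Finset.add_sum_erase _ g hb']
  have : ∑ x ∈ (S.erase a).erase b, f x = ∑ x ∈ (S.erase a).erase b, g x := by
    refine Finset.sum_congr rfl fun x hx => ?_
    simp only [Finset.mem_erase] at hx
    exact hfg x hx.2.2 hx.2.1 hx.1
  omega

/-- Rearrangement argument: take `g` maximizing `∑ k * K (g k)`. At a node where the keys do not
ascend, multiplying by `s i` would increase the sum. -/
theorem exists_isSortedBy {K : ℤ → ℤ} (hodd : ∀ x, K (-x) = -K x)
    (hinj : ∀ x ∈ Set.Icc (-n : ℤ) n, ∀ y ∈ Set.Icc (-n : ℤ) n, K x = K y → x = y) :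
    ∃ g : W n, IsSortedBy K g := by
  obtain ⟨g, hg⟩ := Finite.exists_max fun g : W n => ∑ k ∈ Finset.Icc (1 : ℤ) n, k * K (val g k)
  refine ⟨g, fun i => ?_⟩
  by_contra hi
  refine (hg (g * s i)).not_gt ?_
  have hc := node_cases i
  have hne : K (val g i) ≠ K (val g (|(i : ℤ)| + 1)) := by
    intro h
    have := hinj _ ((val_mem_Icc g).2 (by rw [Set.mem_Icc]; omega)) _
      ((val_mem_Icc g).2 (by rw [Set.mem_Icc]; omega)) h
    rw [val_inj] at this
    omega
  simp only [val_mul]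
  rcases hc with ⟨h1, h2, h3⟩ | ⟨h1, h2, h3⟩
  · rw [h2, h1, val_neg, hodd] at hi hne
    norm_num at hi hne
    refine sum_lt_sum_of_pair (a := 1) (b := 2) (by norm_num) (Finset.mem_Icc.2 (by omega))
      (Finset.mem_Icc.2 (by omega)) (fun x hx hx1 hx2 => ?_) ?_
    · have hx' := Finset.mem_Icc.1 hx
      rw [val_s_neg_one i h1, if_neg hx1, if_neg hx2, if_neg (by omega), if_neg (by omega)]
    · rw [val_s_neg_one i h1, val_s_neg_one i h1]
      norm_num [val_neg, hodd]
      omega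
  · rw [h2] at hi hne
    refine sum_lt_sum_of_pair (a := i) (b := i + 1) (by omega) (Finset.mem_Icc.2 (by omega))
      (Finset.mem_Icc.2 (by omega)) (fun x hx hx1 hx2 => ?_) ?_
    · have hx' := Finset.mem_Icc.1 hx
      rw [val_s_pos i h1, if_neg hx1, if_neg hx2, if_neg (by omega), if_neg (by omega)]
    · rw [val_s_pos i h1, val_s_pos i h1, if_pos rfl, if_neg (by omega), if_pos rfl]
      have : K (val g (i + 1)) < K (val g i) := by omega
      linarith

/-! ### Elements with a prescribed set of values at the last positions -/

/-- A set of values that contains no pair of opposite values and leaves some value `f` free. -/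
def IsRightSet (n : ℕ) (S : Set ℤ) : Prop :=
  S ⊆ Set.Icc (-n : ℤ) n ∧ (∀ x ∈ S, -x ∉ S) ∧
    ∃ f ∈ Set.Icc (-n : ℤ) n, f ≠ 0 ∧ f ∉ S ∧ -f ∉ S

open Classical in
/-- The class `1` of the values in `S`, `-1` of the values in `-S`, and `0` of all others. -/
noncomputable def side (S : Set ℤ) (x : ℤ) : ℤ := if x ∈ S then 1 else if -x ∈ S then -1 else 0

theorem side_eq_one {S : Set ℤ} {x : ℤ} : side S x = 1 ↔ x ∈ S := by
  unfold side; split_ifs <;> simp_all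

theorem side_neg {S : Set ℤ} (hS : ∀ x ∈ S, -x ∉ S) (x : ℤ) : side S (-x) = -side S x := by
  have h1 := hS x
  unfold side
  rw [neg_neg]
  split_ifs <;> simp_all

theorem side_eq_neg_one {S : Set ℤ} (hS : ∀ x ∈ S, -x ∉ S) {x : ℤ} :
    side S x = -1 ↔ -x ∈ S := by
  rw [← side_eq_one, side_neg hS]; omega

theorem side_cases (S : Set ℤ) (x : ℤ) : side S x = -1 ∨ side S x = 0 ∨ side S x = 1 := by
  unfold side; split_ifs <;> simp

/-- The key that sorts by `side S` first and by value second. -/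
noncomputable def sideKey (n : ℕ) (S : Set ℤ) (x : ℤ) : ℤ := side S x * (2 * n + 1) + x

theorem sideKey_neg {S : Set ℤ} (hS : ∀ x ∈ S, -x ∉ S) (x : ℤ) :
    sideKey n S (-x) = -sideKey n S x := by
  rw [sideKey, sideKey, side_neg hS]; ring

/-- The weight `2 * n + 1` exceeds the difference of any two values in `[-n, n]`, so the key
compares lexicographically. -/
theorem sideKey_lt_iff {S : Set ℤ} {x y : ℤ} (hx : x ∈ Set.Icc (-n : ℤ) n)
    (hy : y ∈ Set.Icc (-n : ℤ) n) : sideKey n S x < sideKey n S y ↔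
      side S x < side S y ∨ side S x = side S y ∧ x < y := by
  rw [Set.mem_Icc] at hx hy
  unfold sideKey
  rcases side_cases S x with h | h | h <;> rcases side_cases S y with h' | h' | h' <;>
    rw [h, h'] <;> omega

theorem mem_inversions_of_isSortedBy {S : Set ℤ} (hS : ∀ x ∈ S, -x ∉ S) (hn : 2 ≤ n) {g : W n}
    (hg : IsSortedBy (sideKey n S) g) {x y : ℤ} : (x, y) ∈ inversions g ↔
      (x ∈ Set.Icc (-n : ℤ) n ∧ y ∈ Set.Icc (-n : ℤ) n) ∧
        x ≠ 0 ∧ y ≠ 0 ∧ x + y ≠ 0 ∧ x < y ∧ side S y < side S x := by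
  rw [mem_inversions]
  refine and_congr_right fun hr => and_congr_right fun hx => and_congr_right fun hy =>
    and_congr_right fun hxy => and_congr_right fun hlt => ?_
  have key : ∀ x ∈ Set.Icc (-n : ℤ) n, ∀ y ∈ Set.Icc (-n : ℤ) n, x ≠ 0 → y ≠ 0 → x + y ≠ 0 →
      val g⁻¹ x < val g⁻¹ y → sideKey n S x < sideKey n S y := by
    intro x hx y hy hx0 hy0 hxy hlt
    have := hg.lt (sideKey_neg hS) hn ((val_ne_zero g⁻¹).2 hx0) ((val_ne_zero g⁻¹).2 hy0)
      ((val_add_ne_zero g⁻¹).2 hxy) hlt ((val_mem_Icc g⁻¹).2 hx).1 ((val_mem_Icc g⁻¹).2 hy).2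
    rwa [val_val_inv, val_val_inv] at this
  have h1 := sideKey_lt_iff (S := S) hr.1 hr.2
  have h2 := sideKey_lt_iff (S := S) hr.2 hr.1
  have h3 := key _ hr.1 _ hr.2 hx hy hxy
  have h4 := key _ hr.2 _ hr.1 hy hx (by omega)
  have h5 : val g⁻¹ x ≠ val g⁻¹ y := fun h => hlt.ne ((val_inj _).1 h)
  omega

theorem exists_isSortedBy_sideKey {S : Set ℤ} (hS : ∀ x ∈ S, -x ∉ S) :
    ∃ g : W n, IsSortedBy (sideKey n S) g := by
  refine exists_isSortedBy (sideKey_neg hS) fun x hx y hy h => ?_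
  have h1 := sideKey_lt_iff (S := S) hx hy
  have h2 := sideKey_lt_iff (S := S) hy hx
  have h3 := lt_trichotomy (side S x) (side S y)
  omega

theorem eq_of_isSortedBy_sideKey {S : Set ℤ} (hS : ∀ x ∈ S, -x ∉ S) (hn : 2 ≤ n) {g h : W n}
    (hg : IsSortedBy (sideKey n S) g) (hh : IsSortedBy (sideKey n S) h) : g = h := by
  apply inversions_injective
  ext ⟨x, y⟩
  rw [mem_inversions_of_isSortedBy hS hn hg, mem_inversions_of_isSortedBy hS hn hh]

/-- The sides of `g 1, …, g n` read `0, …, 0, 1, …, 1`. Values ascend while the side is constant, so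
a descent marks the border. -/
theorem image_Icc_eq_of_isSortedBy {S : Set ℤ} (hS : IsRightSet n S) (hn : 2 ≤ n) {g : W n}
    (hg : IsSortedBy (sideKey n S) g) {i : Node n} (hi : i ∈ des g) :
    val g '' Set.Icc (|(i : ℤ)| + 1) n = S := by
  obtain ⟨hSn, hS', f, hfn, hf0, hfS, hfS'⟩ := hS
  have hc := node_cases i
  have hmono : ∀ {P Q : ℤ}, P ≠ 0 → Q ≠ 0 → P + Q ≠ 0 → P < Q → -n ≤ P → Q ≤ n →
      side S (val g P) ≤ side S (val g Q) := by
    intro P Q hP hQ hPQ hlt hPn hQn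
    have h1 := hg.lt (sideKey_neg hS') hn hP hQ hPQ hlt hPn hQn
    rw [sideKey_lt_iff ((val_mem_Icc g).2 ⟨hPn, by omega⟩)
      ((val_mem_Icc g).2 ⟨by omega, hQn⟩)] at h1
    omega
  have hneg : ∀ x, side S (val g (-x)) = -side S (val g x) := fun x => by
    rw [val_neg, side_neg hS']
  have hfree : ∃ F : ℤ, 1 ≤ F ∧ F ≤ n ∧ side S (val g F) = 0 := by
    have hf : side S f = 0 := by
      have h1 := mt side_eq_one.1 hfS
      have h2 := mt (side_eq_neg_one hS').1 hfS'
      have := side_cases S f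
      omega
    have h1 := (val_mem_Icc g⁻¹).2 hfn
    have h2 := (val_ne_zero g⁻¹).2 hf0
    rw [Set.mem_Icc] at h1
    rcases lt_or_gt_of_ne h2 with h3 | h3
    · refine ⟨-val g⁻¹ f, by omega, by omega, ?_⟩
      rw [hneg, val_val_inv, hf, neg_zero]
    · exact ⟨val g⁻¹ f, by omega, by omega, by rw [val_val_inv, hf]⟩
  obtain ⟨F, hF1, hFn, hF⟩ := hfree
  -- Both `1` and `-1` are at most `F`, so the side at `1` and its negative are both at most `0`.
  -- This is where the free value matters.
  have hone : side S (val g 1) = 0 := by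
    have h1 := hneg 1
    rcases eq_or_lt_of_le hF1 with h | h
    · rwa [h]
    · have h2 := hmono (P := 1) (Q := F) (by omega) (by omega) (by omega) h (by omega) hFn
      have h3 := hmono (P := -1) (Q := F) (by omega) (by omega) (by omega) (by omega) (by omega) hFn
      omega
  have hnonneg : ∀ j : ℤ, 1 ≤ j → j ≤ n → 0 ≤ side S (val g j) := by
    intro j hj hjn
    rcases eq_or_lt_of_le hj with rfl | h
    · exact hone.ge
    · rw [← hone]
      exact hmono (by omega) (by omega) (by omega) h (by omega) hjn
  have hdes := not_isAscent_iff.1 (mem_des.1 hi)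
  have hlt : side S (val g i) < side S (val g (|(i : ℤ)| + 1)) := by
    have h1 := hg i
    rw [sideKey_lt_iff ((val_mem_Icc g).2 (by rw [Set.mem_Icc]; omega))
      ((val_mem_Icc g).2 (by rw [Set.mem_Icc]; omega))] at h1
    omega
  have habs : side S (val g i) = 0 ∧ side S (val g |(i : ℤ)|) = 0 := by
    have h1 := side_cases S (val g (|(i : ℤ)| + 1))
    rcases hc with ⟨h, h', -⟩ | ⟨h, h', h''⟩
    · rw [h', h, hneg, hone]; simp
    · rw [h']
      have := hnonneg i h (by omega)
      omega
  have hsucc : side S (val g (|(i : ℤ)| + 1)) = 1 := by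
    have h1 := side_cases S (val g (|(i : ℤ)| + 1))
    omega
  ext x
  constructor
  · rintro ⟨P, ⟨hP, hPn⟩, rfl⟩
    rw [← side_eq_one]
    have h1 := side_cases S (val g P)
    rcases eq_or_lt_of_le hP with h | h
    · rwa [← h]
    · have := hmono (P := |(i : ℤ)| + 1) (Q := P) (by omega) (by omega) (by omega) h (by omega) hPn
      omega
  · intro hx
    refine ⟨val g⁻¹ x, ?_, val_val_inv g x⟩
    obtain ⟨P, rfl⟩ : ∃ P, val g P = x := ⟨_, val_val_inv g x⟩
    have hPn := (val_mem_Icc g).1 (hSn hx)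
    rw [val_inv_val]
    rw [← side_eq_one] at hx
    rw [Set.mem_Icc] at *
    refine ⟨?_, hPn.2⟩
    by_contra hP
    have hP0 : P ≠ 0 := by
      rintro rfl
      have h1 := hneg 0
      rw [neg_zero] at h1
      omega
    rcases lt_or_gt_of_ne hP0 with h | h
    · have h1 := hnonneg (-P) (by omega) (by omega)
      rw [hneg] at h1
      omega
    · rcases eq_or_lt_of_le (show P ≤ |(i : ℤ)| by omega) with h1 | h1
      · rw [h1] at hx
        omega
      · have := hmono (P := P) (Q := |(i : ℤ)|) (by omega) (by omega) (by omega) h1 (by omega)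
          (by omega)
        omega

/-! ### A join-irreducible element is determined by `R` -/

theorem R_eq {u : W n} {i : Node n} (hu : IsJoinIrreducible u) (hi : des u = {i}) :
    R u = val u '' Set.Icc (|(i : ℤ)| + 1) n := by
  ext x
  constructor
  · rintro ⟨l, ⟨-, hl⟩, hx⟩
    rw [hi, Set.singleton_eq_singleton_iff] at hl
    rwa [hl]
  · exact fun hx => ⟨i, ⟨hu, hi⟩, hx⟩

theorem isSortedBy_sideKey_R {u : W n} (hu : IsJoinIrreducible u) :
    (∀ x ∈ R u, -x ∉ R u) ∧ IsSortedBy (sideKey n (R u)) u := by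
  obtain ⟨i, hi⟩ := exists_des_eq_singleton hu
  have hc := node_cases i
  have hmem : ∀ P, val u P ∈ R u ↔ |(i : ℤ)| + 1 ≤ P ∧ P ≤ n := by
    intro P
    rw [R_eq hu hi, ← Set.mem_Icc]
    exact (u : Equiv.Perm ℤ).injective.mem_set_image
  have hdisj : ∀ x ∈ R u, -x ∉ R u := by
    intro x
    obtain ⟨P, rfl⟩ : ∃ P, val u P = x := ⟨_, val_val_inv u x⟩
    rw [← val_neg, hmem, hmem]
    omega
  refine ⟨hdisj, fun j => ?_⟩
  have hj := node_cases j
  rw [sideKey_lt_iff ((val_mem_Icc u).2 (by rw [Set.mem_Icc]; omega))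
    ((val_mem_Icc u).2 (by rw [Set.mem_Icc]; omega))]
  have hside : ∀ P, side (R u) (val u P) =
      if |(i : ℤ)| + 1 ≤ P ∧ P ≤ n then 1 else if |(i : ℤ)| + 1 ≤ -P ∧ -P ≤ n then -1 else 0 := by
    intro P
    classical
    rw [← if_congr (hmem P) rfl rfl, ← if_congr (hmem (-P)) rfl rfl, val_neg]
    unfold side
    congr
  rw [hside, hside]
  -- Absolute values are compared because `-1` and `1` both sit at the border when either is the
  -- type.
  by_cases hij : |(j : ℤ)| = |(i : ℤ)|
  · left
    split_ifs <;> omega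
  · right
    have hA : IsAscent u j := by
      by_contra h
      rw [← mem_des, hi, Set.mem_singleton_iff] at h
      exact hij (by rw [h])
    refine ⟨?_, hA⟩
    split_ifs <;> omega

/-- A join-irreducible element is determined by the values at its last positions. -/
theorem eq_of_R_eq (hn : 2 ≤ n) {u v : W n} (hu : IsJoinIrreducible u) (hv : IsJoinIrreducible v)
    (h : R u = R v) : u = v := by
  obtain ⟨h1, h2⟩ := isSortedBy_sideKey_R hu
  have h3 := (isSortedBy_sideKey_R hv).2
  rw [← h] at h3
  exact eq_of_isSortedBy_sideKey h1 hn h2 h3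

/-! ### The sets `Rset w d` and the least elements they define -/

theorem mem_X_iff {w : W n} {d : Node n} {z : ℤ} :
    z ∈ X w d ↔ |(d : ℤ)| + 1 ≤ val w⁻¹ z ∧ val w⁻¹ z ≤ n := by
  constructor
  · rintro ⟨P, hP, rfl⟩
    rwa [val_inv_val]
  · exact fun h => ⟨_, h, val_val_inv w z⟩

/-- Besides turning intervals into inequalities, this records what condition (A) or its failure
provides: all nonzero values strictly between `-a` and `a` lie in `±X`, or one of them stands at a
positive position left of `d`. If `a < 0` and `a + b < 0`, then (A) holds automatically. -/
theorem mem_Rset_cases (w : W n) (d : Node n) :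
    (0 < a w d ∧ a w d + b w d < 0 ∧
      (∀ z ∈ Set.Icc (-a w d + 1) (a w d - 1), z ≠ 0 → z ∈ X w d ∨ -z ∈ X w d) ∧
      ∀ x, x ∈ Rset w d ↔ x = -a w d ∨
        (x ≠ 0 ∧ -a w d < x ∧ x < a w d ∧ x ∈ X w d) ∨
        (a w d < x ∧ x < -b w d ∧ -x ∉ X w d) ∨ (-b w d < x ∧ x ≤ n)) ∨
    (a w d < 0 ∧ a w d + b w d < 0 ∧
      ∀ x, x ∈ Rset w d ↔
        (-a w d ≤ x ∧ x < -b w d ∧ -x ∉ X w d) ∨ (-b w d < x ∧ x ≤ n)) ∨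
    (0 < a w d + b w d ∧
      ∀ x, x ∈ Rset w d ↔
        (b w d ≤ x ∧ x < a w d ∧ x ∈ X w d) ∨ (a w d < x ∧ x ≤ n)) ∨
    (0 < a w d ∧ a w d + b w d < 0 ∧
      (∃ p ∈ Set.Ioo (-a w d) (a w d), 0 < val w⁻¹ p ∧ val w⁻¹ p < d) ∧
      ∀ x, x ∈ Rset w d ↔
        (b w d ≤ x ∧ x < a w d ∧ x ∈ X w d) ∨
        (a w d < x ∧ x < -b w d ∧ -x ∉ X w d) ∨ (-b w d < x ∧ x ≤ n)) := by
  have hc := node_cases d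
  have ha0 : a w d ≠ 0 := (val_ne_zero w).2 (by omega)
  have hab : a w d + b w d ≠ 0 := (val_add_ne_zero w).2 (by omega)
  by_cases hA : CondA w d
  · by_cases hpos : 0 < a w d
    · refine Or.inl ⟨hpos, hA.1, fun z hz hz0 => ?_, fun x => ?_⟩
      · rw [Set.mem_Icc] at hz
        have haI : a w d ∈ Set.Icc (-n : ℤ) n := (val_mem_Icc w).2 (by rw [Set.mem_Icc]; omega)
        rw [Set.mem_Icc] at haI
        have h1 : z ∈ Set.Icc (-n : ℤ) n := by rw [Set.mem_Icc]; omega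
        have h2 := (val_mem_Icc w⁻¹).2 h1
        rw [Set.mem_Icc] at h2
        have h3 := (val_ne_zero w⁻¹).2 hz0
        have key : ∀ t : ℤ, 1 ≤ t → t ≤ |(d : ℤ)| → a w d ≤ val w t ∨ a w d ≤ -val w t := by
          intro t ht ht'
          have := hA.2 ⟨t, ⟨ht, ht'⟩, rfl⟩
          rcases this with h | h
          · exact Or.inl h.1
          · exact Or.inr h.1
        rw [mem_X_iff, mem_X_iff, val_neg]
        by_contra hcon
        rcases lt_or_gt_of_ne h3 with h4 | h4
        · have := key (-val w⁻¹ z) (by omega) (by omega)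
          rw [val_neg, val_val_inv] at this
          omega
        · have := key (val w⁻¹ z) (by omega) (by omega)
          rw [val_val_inv] at this
          omega
      · rw [Rset, if_pos hA, if_pos hpos]
        simp only [Set.mem_union, Set.mem_inter_iff, Set.mem_sdiff, Set.mem_Icc, negSet, pm,
          Set.mem_ofPred_eq, Set.mem_singleton_iff, mem_X_iff]
        omega
    · refine Or.inr (Or.inl ⟨by omega, hA.1, fun x => ?_⟩)
      rw [Rset, if_pos hA, if_neg hpos]
      simp only [Set.mem_union, Set.mem_sdiff, Set.mem_Icc, negSet, Set.mem_ofPred_eq, mem_X_iff]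
      omega
  · by_cases hs : 0 < a w d + b w d
    · refine Or.inr (Or.inr (Or.inl ⟨hs, fun x => ?_⟩))
      rw [Rset, if_neg hA, if_pos hs]
      simp only [Set.mem_union, Set.mem_inter_iff, Set.mem_Icc, mem_X_iff]
      omega
    · have hs' : a w d + b w d < 0 := by omega
      have hp : ∃ t ∈ Set.Icc (1 : ℤ) |(d : ℤ)|, -a w d < val w t ∧ val w t < a w d := by
        by_contra! h
        refine hA ⟨hs', ?_⟩
        rintro _ ⟨t, ht, rfl⟩
        have h1 := h t ht
        rw [Set.mem_Icc] at ht
        have h2 := (val_mem_Icc w (x := t)).2 (by rw [Set.mem_Icc]; omega)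
        rw [Set.mem_Icc] at h2
        simp only [pm, negSet, Set.mem_union, Set.mem_Icc, Set.mem_ofPred_eq]
        omega
      obtain ⟨t, ht, ht1, ht2⟩ := hp
      refine Or.inr (Or.inr (Or.inr ⟨by omega, hs', ⟨val w t, ⟨ht1, ht2⟩, ?_⟩, fun x => ?_⟩))
      · rw [val_inv_val]
        rw [Set.mem_Icc] at ht
        have h1 : t ≠ d := by
          rintro rfl
          exact ht2.ne rfl
        -- This excludes the node `-1`, where position `1` carries `-a`.
        have h2 : t ≠ -d := by
          rintro rfl
          rw [val_neg] at ht1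
          exact ht1.ne rfl
        omega
      · rw [Rset, if_neg hA, if_neg hs]
        simp only [Set.mem_union, Set.mem_inter_iff, Set.mem_sdiff, Set.mem_Icc, negSet,
          Set.mem_ofPred_eq, mem_X_iff]
        omega

/-- The positions of the values `a w d` and `b w d` and the ranges of these values. -/
theorem a_b_facts {w : W n} {d : Node n} (hd : d ∈ des w) :
    val w⁻¹ (a w d) = d ∧ val w⁻¹ (b w d) = |(d : ℤ)| + 1 ∧ a w d ∈ Set.Icc (-n : ℤ) n ∧
      b w d ∈ Set.Icc (-n : ℤ) n ∧ a w d ≠ 0 ∧ b w d ≠ 0 ∧ b w d + a w d ≠ 0 ∧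
      b w d < a w d := by
  have hc := node_cases d
  refine ⟨val_inv_val _ _, val_inv_val _ _, (val_mem_Icc w).2 ?_, (val_mem_Icc w).2 ?_,
    (val_ne_zero w).2 ?_, (val_ne_zero w).2 ?_, (val_add_ne_zero w).2 ?_,
    not_isAscent_iff.1 (mem_des.1 hd)⟩
  · rw [Set.mem_Icc]; omega
  · rw [Set.mem_Icc]; omega
  all_goals omega

/-- In case (A) the set contains `-a` and leaves `b` free; in case (B) it contains `b` and leaves
`a` free. -/
theorem isRightSet_Rset {w : W n} {d : Node n} (hd : d ∈ des w) :
    IsRightSet n (Rset w d) := by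
  have hc := node_cases d
  obtain ⟨hOA, hOB, hA, hB, hA0, hB0, hAB, hlt⟩ := a_b_facts hd
  rw [Set.mem_Icc] at hA hB
  have hO : ∀ z, val w⁻¹ (-z) = -val w⁻¹ z := val_neg w⁻¹
  have hOA' := hO (a w d)
  have hOB' := hO (b w d)
  rcases mem_Rset_cases w d with ⟨h1, h2, -, h4⟩ | ⟨h1, h2, h4⟩ | ⟨h2, h4⟩ | ⟨h1, h2, -, h4⟩
  · refine ⟨fun x hx => ?_, fun x => ?_, b w d, hB, hB0, ?_⟩
    · rw [h4] at hx
      rw [Set.mem_Icc]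
      omega
    · have := hO x
      simp only [h4, mem_X_iff, neg_neg]
      omega
    · simp only [h4, mem_X_iff, neg_neg]
      omega
  · refine ⟨fun x hx => ?_, fun x => ?_, b w d, hB, hB0, ?_⟩
    · rw [h4] at hx
      rw [Set.mem_Icc]
      omega
    · have := hO x
      simp only [h4, mem_X_iff, neg_neg]
      omega
    · simp only [h4, mem_X_iff, neg_neg]
      omega
  · refine ⟨fun x hx => ?_, fun x => ?_, a w d, hA, hA0, ?_⟩
    · rw [h4] at hx
      rw [Set.mem_Icc]
      omega
    · have := hO x
      simp only [h4, mem_X_iff]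
      omega
    · simp only [h4, mem_X_iff]
      omega
  · refine ⟨fun x hx => ?_, fun x => ?_, a w d, hA, hA0, ?_⟩
    · rw [h4] at hx
      rw [Set.mem_Icc]
      omega
    · have := hO x
      simp only [h4, mem_X_iff, neg_neg]
      omega
    · simp only [h4, mem_X_iff, neg_neg]
      omega

/-- `Rset w d` prescribes the inversion of the two values `a w d` and `b w d`. -/
theorem side_a_lt_side_b {w : W n} {d : Node n} (hd : d ∈ des w) :
    side (Rset w d) (a w d) < side (Rset w d) (b w d) := by
  have hc := node_cases d
  obtain ⟨hOA, hOB, hA, hB, hA0, hB0, hAB, hlt⟩ := a_b_facts hd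
  rw [Set.mem_Icc] at hA hB
  have hdisj := (isRightSet_Rset hd).2.1
  have hO : ∀ z, val w⁻¹ (-z) = -val w⁻¹ z := val_neg w⁻¹
  have ea := side_eq_neg_one hdisj (x := a w d)
  have eb := side_eq_neg_one hdisj (x := b w d)
  have fa := side_eq_one (S := Rset w d) (x := a w d)
  have fb := side_eq_one (S := Rset w d) (x := b w d)
  have ca := side_cases (Rset w d) (a w d)
  have cb := side_cases (Rset w d) (b w d)
  rcases mem_Rset_cases w d with ⟨h1, h2, -, h4⟩ | ⟨h1, h2, h4⟩ | ⟨h2, h4⟩ | ⟨h1, h2, -, h4⟩ <;>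
    simp only [h4, mem_X_iff, neg_neg, hO, true_or, iff_true] at ea eb fa fb <;> omega

/-- Below `w`, inverting the values `a w d` and `b w d` forces all inversions prescribed by
`Rset w d`. -/
theorem val_inv_lt_of_mem_Rset {v w : W n} {d : Node n} (hd : d ∈ des w) (hv : v ≤ w)
    (hinv : (b w d, a w d) ∈ inversions v) {x y : ℤ} (hx : x ∈ Rset w d) (hy : y ∉ Rset w d)
    (hyn : y ∈ Set.Icc (-n : ℤ) n) (hy0 : y ≠ 0) (hxy : x < y) (hxy' : x + y ≠ 0) :
    val v⁻¹ y < val v⁻¹ x := by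
  have hc := node_cases d
  obtain ⟨hOA, hOB, hA, hB, hA0, hB0, hAB, hlt⟩ := a_b_facts hd
  have hO : ∀ z, val w⁻¹ (-z) = -val w⁻¹ z := val_neg w⁻¹
  have ho : ∀ z, val v⁻¹ (-z) = -val v⁻¹ z := val_neg v⁻¹
  have hoAB := (mem_inversions.1 hinv).2.2.2.2.2
  -- Values in increasing order in `w` stay in that order in `v ≤ w`; this is the only way `w`
  -- enters the comparison.
  have hasc : ∀ p q : ℤ, p ∈ Set.Icc (-n : ℤ) n → q ∈ Set.Icc (-n : ℤ) n → p ≠ 0 → q ≠ 0 →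
      p + q ≠ 0 → p < q → val w⁻¹ p < val w⁻¹ q → val v⁻¹ p < val v⁻¹ q := by
    intro p q hp hq hp0 hq0 hpq hlt hw
    by_contra hcon
    have hne : val v⁻¹ p ≠ val v⁻¹ q := fun h => hlt.ne ((val_inj _).1 h)
    have h1 := mem_inversions.1 (le_iff_subset.1 hv
      (mem_inversions.2 ⟨⟨hp, hq⟩, hp0, hq0, hpq, hlt, by omega⟩))
    omega
  have hright : ∀ z, z ∈ X w d → b w d ≤ z → val v⁻¹ (b w d) ≤ val v⁻¹ z := by
    intro z hz hbz
    rw [mem_X_iff] at hz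
    rcases eq_or_lt_of_le hbz with h | h
    · rw [h]
    · have hz0 : z ≠ 0 := (val_ne_zero w⁻¹).1 (by omega)
      have hzn : z ∈ Set.Icc (-n : ℤ) n := (val_mem_Icc w⁻¹).1 (by rw [Set.mem_Icc]; omega)
      have hne : val w⁻¹ (b w d) ≠ val w⁻¹ z := fun e => h.ne ((val_inj _).1 e)
      have hne' : b w d + z ≠ 0 := (val_add_ne_zero w⁻¹).1 (by omega)
      exact (hasc _ _ hB hzn hB0 hz0 hne' h (by omega)).le
  have hleft : ∀ z, z ∈ Set.Icc (-n : ℤ) n → z ∉ X w d → z ≠ 0 → z + a w d ≠ 0 → z ≤ a w d →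
      val v⁻¹ z ≤ val v⁻¹ (a w d) := by
    intro z hzn hz hz0 hza hz'
    rcases eq_or_lt_of_le hz' with h | h
    · rw [h]
    · have h1 := (val_mem_Icc w⁻¹).2 hzn
      have h2 := (val_ne_zero w⁻¹).2 hz0
      have h3 := (val_add_ne_zero w⁻¹).2 hza
      have hne : val w⁻¹ z ≠ val w⁻¹ (a w d) := fun e => h.ne ((val_inj _).1 e)
      rw [Set.mem_Icc] at h1
      rw [mem_X_iff] at hz
      exact (hasc _ _ hzn hA hz0 hA0 hza h (by omega)).le
  have hright' : ∀ z, -z ∈ X w d → z ≤ -b w d → val v⁻¹ z ≤ -val v⁻¹ (b w d) := by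
    intro z hz hzb
    have := hright (-z) hz (by omega)
    rw [ho] at this
    omega
  have hleft' : ∀ z, z ∈ Set.Icc (-n : ℤ) n → -z ∉ X w d → z ≠ 0 → z ≠ a w d → -a w d ≤ z →
      -val v⁻¹ (a w d) ≤ val v⁻¹ z := by
    intro z hzn hz hz0 hza hz'
    rw [Set.mem_Icc] at hzn
    have := hleft (-z) (by rw [Set.mem_Icc]; omega) hz (by omega) (by omega) (by omega)
    rw [ho] at this
    omega
  have hoB := ho (b w d)
  have hoA := ho (a w d)
  have hyn' := Set.mem_Icc.1 hyn
  have hA' := Set.mem_Icc.1 hA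
  have hB' := Set.mem_Icc.1 hB
  rcases mem_Rset_cases w d with ⟨h1, h2, h3, h4⟩ | ⟨h1, h2, h4⟩ | ⟨h2, h4⟩ | ⟨h1, h2, h3, h4⟩ <;>
    rw [h4] at hx hy
  -- In case (A) the chain of positions in `v` is `y ≤ -b < -a ≤ x`. The exception `y = a` uses `a <
  -- b ≤ x`, where `x ∈ X w d` because `x = -a` is opposite to `y`.
  · have hxa : -val v⁻¹ (a w d) ≤ val v⁻¹ x := by
      rcases hx with rfl | ⟨hx0, hx1, hx2, hx3⟩ | ⟨hx1, hx2, hx3⟩ | hx1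
      · omega
      · rw [mem_X_iff] at hx3
        have := hasc (-a w d) x (by rw [Set.mem_Icc]; omega) (by rw [Set.mem_Icc]; omega)
          (by omega) hx0 (by omega) hx1 (by rw [hO]; omega)
        omega
      · exact hleft' x (by rw [Set.mem_Icc]; omega) hx3 (by omega) (by omega) (by omega)
      · omega
    by_cases hya : y = a w d
    · rcases hx with rfl | ⟨hx0, hx1, hx2, hx3⟩ | ⟨hx1, hx2, hx3⟩ | hx1
      · omega
      · have := hright x hx3 (by omega)
        rw [hya]
        omega
      · omega
      · omega
    · have hyb : val v⁻¹ y ≤ -val v⁻¹ (b w d) := by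
        rcases eq_or_ne y (-b w d) with h | h
        · rw [h]; omega
        · refine hright' y ?_ ?_
          · by_contra hcon
            by_cases hy1 : y < a w d
            · exact (h3 y (Set.mem_Icc.2 (by omega)) hy0).elim
                (fun h => hy (Or.inr (Or.inl ⟨hy0, by omega, hy1, h⟩))) hcon
            · exact hy (Or.inr (Or.inr (Or.inl ⟨by omega, by omega, hcon⟩)))
          · omega
      omega
  · have hxa : -val v⁻¹ (a w d) ≤ val v⁻¹ x := by
      rcases hx with ⟨hx1, hx2, hx3⟩ | hx1
      · exact hleft' x (by rw [Set.mem_Icc]; omega) hx3 (by omega) (by omega) (by omega)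
      · omega
    have hyb : val v⁻¹ y ≤ -val v⁻¹ (b w d) := by
      rcases eq_or_ne y (-b w d) with h | h
      · rw [h]; omega
      · refine hright' y ?_ (by omega)
        by_contra hcon
        exact hy (Or.inl ⟨by omega, by omega, hcon⟩)
    omega
  · rcases hx with ⟨hx1, hx2, hx3⟩ | hx1
    · have hxb := hright x hx3 hx1
      have hya := hleft y hyn (fun hcon => hy (by
        have : y ≠ a w d := by
          rintro rfl
          rw [mem_X_iff] at hcon
          omega
        by_cases h : y < a w d
        · exact Or.inl ⟨by omega, h, hcon⟩
        · exact Or.inr ⟨by omega, by omega⟩)) hy0 (by omega) (by omega)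
      omega
    · omega
  · obtain ⟨p, ⟨hp1, hp2⟩, hp3, hp4⟩ := h3
    -- Both `p` and `-p` stand left of `a` in `w`, hence also in `v`; their positions are opposite,
    -- so that of `a` is positive. This lets the chains through `a, b` and through `-b, -a` be
    -- combined.
    have hap : 0 < val v⁻¹ (a w d) := by
      have hp0 : p ≠ 0 := (val_ne_zero w⁻¹).1 hp3.ne'
      have e1 := hasc p (a w d) (by rw [Set.mem_Icc]; omega) hA hp0 hA0 (by omega) hp2 (by omega)
      have e2 := hasc (-p) (a w d) (by rw [Set.mem_Icc]; omega) hA (by omega) hA0 (by omega)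
        (by omega) (by rw [hO]; omega)
      rw [ho] at e2
      omega
    have hyb : a w d < y → val v⁻¹ y ≤ -val v⁻¹ (b w d) := by
      intro hay
      rcases eq_or_ne y (-b w d) with h | h
      · rw [h]; omega
      · refine hright' y ?_ (by omega)
        by_contra hcon
        exact hy (Or.inr (Or.inl ⟨by omega, by omega, hcon⟩))
    rcases hx with ⟨hx1, hx2, hx3⟩ | ⟨hx1, hx2, hx3⟩ | hx1
    · have hxb := hright x hx3 hx1
      by_cases hay : a w d < y
      · have := hyb hay
        omega
      · rcases eq_or_ne y (-a w d) with h | h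
        · rw [h]; omega
        · have hya := hleft y hyn (fun hcon => hy (by
            have : y ≠ a w d := by
              rintro rfl
              rw [mem_X_iff] at hcon
              omega
            exact Or.inl ⟨by omega, by omega, hcon⟩)) hy0 (by omega) (by omega)
          omega
    · have hxa := hleft' x (by rw [Set.mem_Icc]; omega) hx3 (by omega) (by omega) (by omega)
      have := hyb (by omega)
      omega
    · omega

/-- For every descent `d` of `w` there is a least element below `w` that inverts `a w d` and
`b w d`; it is join-irreducible and given by `Rset w d`. -/
theorem exists_least_of_mem_des (hn : 2 ≤ n) {w : W n} {d : Node n} (hd : d ∈ des w) :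
    ∃ u : W n, IsJoinIrreducible u ∧ R u = Rset w d ∧ u ≤ w ∧ (b w d, a w d) ∈ inversions u ∧
      ∀ v ≤ w, (b w d, a w d) ∈ inversions v → u ≤ v := by
  have hR := isRightSet_Rset hd
  obtain ⟨hOA, hOB, hA, hB, hA0, hB0, hAB, hlt⟩ := a_b_facts hd
  obtain ⟨u, hu⟩ := exists_isSortedBy_sideKey (n := n) hR.2.1
  have hmem : ∀ x y, (x, y) ∈ inversions u ↔ _ := fun x y =>
    mem_inversions_of_isSortedBy hR.2.1 hn hu
  have hleast : ∀ v ≤ w, (b w d, a w d) ∈ inversions v → u ≤ v := by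
    intro v hv hinv
    rw [le_iff_subset]
    rintro ⟨x, y⟩ hxy
    rw [hmem] at hxy
    obtain ⟨⟨hxn, hyn⟩, hx0, hy0, hxy0, hxy, hside⟩ := hxy
    refine mem_inversions.2 ⟨⟨hxn, hyn⟩, hx0, hy0, hxy0, hxy, ?_⟩
    have hcx := side_cases (Rset w d) x
    have hcy := side_cases (Rset w d) y
    -- If the side drops from `x` to `y`, then `x` lies in `Rset w d` and `y` does not, or this
    -- holds for `-y` and `-x`.
    by_cases hx : side (Rset w d) x = 1
    · exact val_inv_lt_of_mem_Rset hd hv hinv (side_eq_one.1 hx)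
        (fun h => by rw [side_eq_one.2 h] at hside; omega) hyn hy0 hxy hxy0
    · have hy : side (Rset w d) y = -1 := by omega
      rw [Set.mem_Icc] at hxn hyn
      have := val_inv_lt_of_mem_Rset hd hv hinv ((side_eq_neg_one hR.2.1).1 hy)
        (fun h => by rw [(side_eq_neg_one hR.2.1).2 h] at hside; omega)
        (y := -x) (Set.mem_Icc.2 (by omega)) (by omega) (by omega) (by omega)
      rw [val_neg, val_neg] at this
      omega
  have hinvu : (b w d, a w d) ∈ inversions u :=
    (hmem _ _).2 ⟨⟨hB, hA⟩, hB0, hA0, hAB, hlt, side_a_lt_side_b hd⟩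
  have hinvw : (b w d, a w d) ∈ inversions w := by
    refine mem_inversions.2 ⟨⟨hB, hA⟩, hB0, hA0, hAB, hlt, ?_⟩
    rcases node_cases d with h | h <;> omega
  have huw : u ≤ w := hleast w le_rfl hinvw
  -- Going down from `u` at a descent must lose the pair `(b, a)`, by minimality of `u`. All
  -- descents thus carry the same root, so there is only one.
  have hdes : ∀ i ∈ des u, (val u (|(i : ℤ)| + 1), val u i) ∈ rootPair (b w d) (a w d) := by
    intro i hi
    have h0 := isAscent_mul_s.2 (mem_des.1 hi)
    have h1 := inversions_mul_s h0
    have hlt : u * s i < u := hi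
    rw [mul_s_mul_s] at h1
    rw [h1, Finset.mem_union] at hinvu
    rcases hinvu with h2 | h2
    · exact absurd (hleast _ (hlt.le.trans huw) h2) hlt.not_ge
    · rw [rootsAt, val_mul, val_mul, val_s_self, val_s_succ] at h2
      simp only [rootPair, Finset.mem_insert, Finset.mem_singleton, Prod.mk.injEq] at h2 ⊢
      omega
  have hne : u ≠ 1 := by
    rintro rfl
    rw [inversions_one] at hinvu
    exact Finset.notMem_empty _ hinvu
  obtain ⟨i, hi⟩ := exists_not_isAscent hne
  rw [← mem_des] at hi
  have hsingle : des u = {i} := by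
    refine Set.eq_singleton_iff_unique_mem.2 ⟨hi, fun j hj => ?_⟩
    have h1 := hdes i hi
    have h2 := hdes j hj
    have hci := node_cases i
    have hcj := node_cases j
    simp only [rootPair, Finset.mem_insert, Finset.mem_singleton, Prod.mk.injEq] at h1 h2
    have h3 : val u j = val u i ∨ val u j = val u (-(|(i : ℤ)| + 1)) := by
      rw [val_neg]; omega
    have h4 : val u (|(j : ℤ)| + 1) = val u (|(i : ℤ)| + 1) ∨
        val u (|(j : ℤ)| + 1) = val u (-i) := by
      rw [val_neg]; omega
    rw [val_inj, val_inj] at h3 h4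
    apply Subtype.ext
    omega
  have hjirr := isJoinIrreducible_of_des hsingle
  refine ⟨u, hjirr, ?_, huw, hinvu, hleast⟩
  rw [R_eq hjirr hsingle]
  exact image_Icc_eq_of_isSortedBy hR hn hu hi

end TypeD

/-! ### The canonical join representation -/

theorem proposition4p7 (n : ℕ) (hn : 2 ≤ n) (w : TypeD.W n) :
    (∀ d ∈ TypeD.des w,
      ∃! u : TypeD.W n, IsJoinIrreducible u ∧ TypeD.R u = TypeD.Rset w d) ∧
    ∀ v : TypeD.Node n → TypeD.W n,
      (∀ d ∈ TypeD.des w, IsJoinIrreducible (v d) ∧ TypeD.R (v d) = TypeD.Rset w d) →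
      Set.InjOn v (TypeD.des w) ∧ IsCanonicalJoinRep w (v '' TypeD.des w) := by
  refine ⟨fun d hd => ?_, fun v hv => ?_⟩
  · obtain ⟨u, hu, hR, -⟩ := TypeD.exists_least_of_mem_des hn hd
    exact ⟨u, ⟨hu, hR⟩, fun u' hu' => TypeD.eq_of_R_eq hn hu'.1 hu (hu'.2.trans hR.symm)⟩
  have key : ∀ d ∈ TypeD.des w, v d ≤ w ∧ ¬ v d ≤ w * TypeD.s d ∧
      ∀ x ≤ w, ¬ x ≤ w * TypeD.s d → v d ≤ x := by
    intro d hd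
    obtain ⟨u, hu, hR, huw, hinv, hleast⟩ := TypeD.exists_least_of_mem_des hn hd
    have hvu : v d = u := TypeD.eq_of_R_eq hn (hv d hd).1 hu ((hv d hd).2.trans hR.symm)
    rw [hvu]
    refine ⟨huw, fun h => (TypeD.le_mul_s_iff hd huw).1 h hinv, fun x hx hx' => ?_⟩
    rw [TypeD.le_mul_s_iff hd hx, not_not] at hx'
    exact hleast x hx hx'
  -- For `d ≠ e`, `w * s d` is not below `w * s e`, so it lies above the least such element `v e`.
  have hother : ∀ d ∈ TypeD.des w, ∀ e ∈ TypeD.des w, d ≠ e → v e ≤ w * TypeD.s d := by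
    intro d hd e he hne
    have hlt : w * TypeD.s d < w := hd
    exact (key e he).2.2 _ hlt.le fun h => hne (TypeD.mul_s_le_mul_s hd he h)
  refine ⟨fun d hd e he hde => ?_, ⟨TypeD.isLUB_of_forall_des ?_ fun d hd => ?_,
    fun U' hU' hlub => ?_⟩, fun V hV => ?_⟩
  · by_contra hne
    exact (key d hd).2.1 (hde.trans_le (hother d hd e he hne))
  · rintro _ ⟨d, hd, rfl⟩
    exact (key d hd).1
  · exact ⟨v d, ⟨d, hd, rfl⟩, (key d hd).2.1⟩
  · obtain ⟨_, ⟨d, hd, rfl⟩, hdU⟩ := Set.exists_of_ssubset hU'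
    have hlt : w * TypeD.s d < w := hd
    -- A proper subset omits some `v d`, and all remaining elements lie below `w * s d`.
    refine hlt.not_ge (hlub.2 fun x hx => ?_)
    obtain ⟨e, he, rfl⟩ := hU'.1 hx
    exact hother d hd e he fun hde => hdU (hde ▸ hx)
  · rintro _ ⟨d, hd, rfl⟩
    have hlt : w * TypeD.s d < w := hd
    by_contra! hcon
    -- If no member of `V` were above `v d`, all of them would lie below `w * s d`, and so would
    -- their join `w`.
    refine hlt.not_ge (hV.1.2 fun x hx => ?_)
    by_contra hx'
    exact hcon x hx ((key d hd).2.2 x (hV.1.1 hx) hx')
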